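/- **Setting.** Let $n,q\in\mathbb N$ and consider $\min_{x\in\mathbb R^n}\Phi_h(x):=f(x)+h(c(x))$, where $f:\mathbb R^n\to\mathbb R$ and $c:\mathbb R^n\to\mathbb R^q$ are continuously differentiable, $f$ is bounded below, $\nabla f$ and the Jacobian $J$ of $c$ are globally Lipschitz with constants $L_g$ and $L_J$, $h:\mathbb R^q\to\mathbb R$ is convex and $L_h$-Lipschitz, and $\Phi_h\ge\Phi_h^{low}$ on $\mathbb R^n$. Put $L:=L_g+L_hL_J$ and assume $L>0$. A stochastic zeroth-order oracle ($\mathcal{SZO}$) returns $F(x,\xi)$, where $\xi$ is random with a law that does not depend on $x$; $F(\cdot,\xi)$ is continuously differentiable with $L_g$-Lipschitz gradient $G(\cdot,\xi):=\nabla_xF(\cdot,\xi)$ for every $\xi$, and $\mathbb E_\xi[F(x,\xi)]=f(x)$ for all $x$. For $\gamma>0$ and $x,g\in\mathbb R^n$ let $$P_\gamma(x,g):=\tfrac1\gamma(x-x^+),\qquad x^+:=\operatorname*{argmin}_{u\in\mathbb R^n}\ \langle g,u-x\rangle+h\big(c(x)+J(x)(u-x)\big)+\tfrac1{2\gamma}\|u-x\|^2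 ,$$ and for $\mu>0$ let $G_\mu(x,\xi,v):=\frac{F(x+\mu v,\xi)-F(x,\xi)}{\mu}\,v$. **Algorithm.** Given $x_1\in\mathbb R^n$, a maximum iteration number $N$, stepsizes $\gamma_k>0$, batch sizes $m_k\ge1$, $\mu>0$ and a random index $R\in\{1,\dots,N\}$: for $k=1,\dots,R-1$ call the $\mathcal{SZO}$ $m_k$ times to obtain $G_{\mu,k}:=\frac1{m_k}\sum_{i=1}^{m_k}G_\mu(x_k,\xi_{k,i},v_{k,i})$ (one call is counted for each sample $G_\mu$) and set $x_{k+1}:=x_k-\gamma_kP_{\gamma_k}(x_k,G_{\mu,k})$; the output is $x_R$. The $\xi_{k,i}$ are independent copies of $\xi$, the $v_{k,i}$ are standard Gaussian vectors in $\mathbb R^n$, and all $\xi_{k,i}$, $v_{k,i}$ and $R$ are independent. Write $$\tilde g_k:=P_{\gamma_k}(x_k,\nabla f(x_k)),\qquad \tilde g^r_{\mu,k}:=P_{\gamma_k}(x_k,G_{\mu,k}).$$ **Theorem.** Let $\sigma,\kappa_g,\tilde D_1,\tilde D_2>0$ be constants, and let $D_{\Phi_h}:=\Phi_h(x_1)-\Phi_h^{low}$.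 Let $\gamma_k=1/L$ for all $k$, let $\mathrm{Prob}\{R=k\}=\frac{\gamma_k-L\gamma_k^2/2}{\sum_{j=1}^N(\gamma_j-L\gamma_j^2/2)}$ for $k=1,\dots,N$, and suppose that for $k=1,\dots,N$, almost surely, $\|\nabla f(x_k)\|\le\kappa_g$, $\mathbb E_\xi[G(x_k,\xi)]=\nabla f(x_k)$ and $\mathbb E_\xi[\|G(x_k,\xi)-\nabla f(x_k)\|^2]\le\sigma^2$. Let $\epsilon>0$, let $\bar N\in\mathbb N$ be the total budget of $\mathcal{SZO}$-calls, and suppose that $0<\mu\le\sqrt{\tilde D_1/\bar N}$, that $m_k=m$ for all $k$ with $$m=\Big\lceil\min\Big\{\bar N,\max\Big\{1,\tfrac1L\sqrt{\bar N/\tilde D_2}\Big\}\Big\}\Big\rceil ,$$ that $N=\lceil\bar N/m\rceil$, and that $$\bar N\ \ge\ \max\left\{\frac{\big(16D_{\Phi_h}/\sqrt{\tilde D_2}+L\tilde C_1\big)^2}{\epsilon^2}+\frac{104\,LL_g\tilde D_1(n+4)^3+64LD_{\Phi_h}}{\epsilon},\ \frac1{L^2\tilde D_2}\right\},\qquad \tilde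 C_1:=24(n+4)(\kappa_g^2+\sigma^2)\sqrt{\tilde D_2}.$$ Then $$\mathbb E\big[\|\tilde g^r_{\mu,R}\|^2\big]\le\epsilon\qquad\text{and}\qquad\mathbb E\big[\|\tilde g_R\|^2\big]\le\epsilon ,$$ where the expectations (which are finite) are taken with respect to $R$, all $\xi_{k,i}$ and all $v_{k,i}$, and the algorithm makes at most $\bar N$ $\mathcal{SZO}$-calls. Consequently the number of $\mathcal{SZO}$-calls that the algorithm requires to achieve both inequalities is $O(\epsilon^{-2})$: there is a constant $C$, depending only on $n,q,L_g,L_h,L_J,\sigma,\kappa_g,\tilde D_1,\tilde D_2$ and $D_{\Phi_h}$, such that for every $\epsilon\in(0,1]$ some budget $\bar N\le C\epsilon^{-2}$ satisfies the bound above and so guarantees both inequalities. -/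

import Mathlib

open MeasureTheory ProbabilityTheory
open scoped NNReal

universe u w

noncomputable section

namespace ZOComposite

/-- `ℝⁿ` with the Euclidean norm. -/
abbrev E (n : ℕ) : Type := EuclideanSpace ℝ (Fin n)

variable {n q : ℕ} {Ξ : Type*}

/-! ### The composite problem and the generalized gradient -/

/-- The objective `Φ_h(x) = f(x) + h(c(x))`. -/
def Phi (f : E n → ℝ) (c : E n → E q) (h : E q → ℝ) (x : E n) : ℝ := f x + h (c x)

/-- The model `ψ_γ(x,g,u) = ⟨g, u - x⟩ + h(c(x) + J(x)(u - x)) + ‖u - x‖² / (2γ)`,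
where the Jacobian `J(x)` is the Fréchet derivative of `c` at `x`. -/
def psi (c : E n → E q) (h : E q → ℝ) (γ : ℝ) (x g u : E n) : ℝ :=
  inner ℝ g (u - x) + h (c x + fderiv ℝ c x (u - x)) + 1 / (2 * γ) * ‖u - x‖ ^ 2

/-- `x⁺ = argmin_u ψ_γ(x,g,u)`. For `h` convex and Lipschitz and `γ > 0` the minimizer exists and
is unique (`existsUnique_isMinOn_psi`, `proxPoint_isMinOn`). -/
def proxPoint (c : E n → E q) (h : E q → ℝ) (γ : ℝ) (x g : E n) : E n :=
  Classical.epsilon fun u => IsMinOn (psi c h γ x g) Set.univ u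

/-- The generalized gradient `P_γ(x,g) = (x - x⁺) / γ`. -/
def genGrad (c : E n → E q) (h : E q → ℝ) (γ : ℝ) (x g : E n) : E n :=
  (1 / γ) • (x - proxPoint c h γ x g)

/-! ### Gaussian smoothing and the zeroth-order gradient estimator -/

/-- The Gaussian smoothing `f_μ(x) = 𝔼_v[f(x + μ v)]`, with `v` standard Gaussian on `ℝⁿ`. -/
def gaussSmooth (f : E n → ℝ) (μ : ℝ) (x : E n) : ℝ :=
  ∫ v, f (x + μ • v) ∂(stdGaussian (E n))

/-- `G(x,s) = ∇ₓ F(x,s)`. -/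
def oracleGrad (F : E n → Ξ → ℝ) (x : E n) (s : Ξ) : E n := gradient (fun y => F y s) x

/-- `G_μ(x,s,v) = ((F(x + μ v, s) - F(x, s)) / μ) v`. -/
def zoGrad (F : E n → Ξ → ℝ) (μ : ℝ) (x : E n) (s : Ξ) (v : E n) : E n :=
  ((F (x + μ • v) s - F x s) / μ) • v

/-- The batch average `(1/m) ∑_{i=1}^m G_μ(x, s_i, v_i)`. -/
def batchGrad (F : E n → Ξ → ℝ) (μ : ℝ) (m : ℕ) (x : E n) (s : ℕ → Ξ) (v : ℕ → E n) : E n :=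
  (1 / (m : ℝ)) • ∑ i ∈ Finset.Icc 1 m, zoGrad F μ x (s i) (v i)

/-! ### The algorithm -/

/-- The iterates `x_1, x_2, …` of the stochastic zeroth-order algorithm, started at `x₁`, as
functions of the samples `s k i`, `v k i` (`k`-th iteration, `i`-th element of the batch):
`x_{k+1} = argmin_u ψ_{γ_k}(x_k, G_{μ,k}, u)`. Iterations are counted from `1`; the value at the
index `0` is a dummy. -/
def iterate (F : E n → Ξ → ℝ) (c : E n → E q) (h : E q → ℝ) (γ : ℕ → ℝ) (m : ℕ → ℕ) (μ : ℝ)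
    (x₁ : E n) (s : ℕ → ℕ → Ξ) (v : ℕ → ℕ → E n) : ℕ → E n
  | 0 => x₁
  | 1 => x₁
  | k + 2 =>
    let x := iterate F c h γ m μ x₁ s v (k + 1)
    proxPoint c h (γ (k + 1)) x
      (batchGrad F μ (m (k + 1)) x (s (k + 1)) (v (k + 1)))

/-- `g̃ʳ_{μ,k} = P_{γ_k}(x_k, G_{μ,k})`. -/
def zoGenGrad (F : E n → Ξ → ℝ) (c : E n → E q) (h : E q → ℝ) (γ : ℕ → ℝ) (m : ℕ → ℕ) (μ : ℝ)
    (x₁ : E n) (s : ℕ → ℕ → Ξ) (v : ℕ → ℕ → E n) (k : ℕ) : E n :=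
  let x := iterate F c h γ m μ x₁ s v k
  genGrad c h (γ k) x (batchGrad F μ (m k) x (s k) (v k))

/-- `g̃_k = P_{γ_k}(x_k, ∇f(x_k))`. -/
def trueGenGrad (f : E n → ℝ) (F : E n → Ξ → ℝ) (c : E n → E q) (h : E q → ℝ) (γ : ℕ → ℝ)
    (m : ℕ → ℕ) (μ : ℝ) (x₁ : E n) (s : ℕ → ℕ → Ξ) (v : ℕ → ℕ → E n) (k : ℕ) : E n :=
  let x := iterate F c h γ m μ x₁ s v k
  genGrad c h (γ k) x (gradient f x)

/-- The number of oracle calls of a run that stops with output `x_R`: the loop runs over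
`k = 1, …, R - 1` and makes `m_k` calls in its `k`-th pass. -/
def szoCalls (m : ℕ → ℕ) (R : ℕ) : ℕ := ∑ k ∈ Finset.Icc 1 (R - 1), m k

/-- The probability mass function
`P_R(k) = (γ_k - L γ_k² / 2) / ∑_{j=1}^N (γ_j - L γ_j² / 2)` for `k = 1, …, N`. -/
def outputPMF (L : ℝ) (γ : ℕ → ℝ) (N k : ℕ) : ℝ :=
  (γ k - L * γ k ^ 2 / 2) / ∑ j ∈ Finset.Icc 1 N, (γ j - L * γ j ^ 2 / 2)

/-- The randomness of a run: the pairs `(ξ k i, v k i)` are independent with law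
`P ⊗ N(0, I)`, and the stopping index `R`, drawn from `P_R` on `{1, …, N}`, is independent of
all of them. -/
structure IsSampling {Ω : Type*} [MeasurableSpace Ω] [MeasurableSpace Ξ] (Pr : Measure Ω)
    (P : Measure Ξ) (L : ℝ) (γ : ℕ → ℝ) (N : ℕ) (ξ : ℕ → ℕ → Ω → Ξ) (v : ℕ → ℕ → Ω → E n)
    (R : Ω → ℕ) : Prop where
  measurable_ξ : ∀ k i, Measurable (ξ k i)
  measurable_v : ∀ k i, Measurable (v k i)
  measurable_R : Measurable R
  map_sample : ∀ k i, Pr.map (fun ω => (ξ k i ω, v k i ω)) = P.prod (stdGaussian (E n))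
  indep_sample : iIndepFun (fun (p : ℕ × ℕ) ω => (ξ p.1 p.2 ω, v p.1 p.2 ω)) Pr
  R_mem : ∀ ω, R ω ∈ Finset.Icc 1 N
  prob_R : ∀ k ∈ Finset.Icc 1 N, Pr.real {ω | R ω = k} = outputPMF L γ N k
  indep_R : IndepFun R (fun ω (p : ℕ × ℕ) => (ξ p.1 p.2 ω, v p.1 p.2 ω)) Pr

/-! ### Standing assumptions -/

/-- `f` and `c` are continuously differentiable, `f` is bounded below, and `∇f` and the Jacobian
`J` are Lipschitz with constants `Lg` and `LJ`. -/
structure AS1 (f : E n → ℝ) (c : E n → E q) (Lg LJ : ℝ≥0) : Prop where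
  contDiff_f : ContDiff ℝ 1 f
  contDiff_c : ContDiff ℝ 1 c
  bddBelow_f : BddBelow (Set.range f)
  lipschitz_grad : LipschitzWith Lg (gradient f)
  lipschitz_jac : LipschitzWith LJ (fderiv ℝ c)

/-- `h` is convex and Lipschitz with constant `Lh`. -/
structure AS2 (h : E q → ℝ) (Lh : ℝ≥0) : Prop where
  convex : ConvexOn ℝ Set.univ h
  lipschitz : LipschitzWith Lh h

/-- `Φ_h` is bounded below by `Φlow`. -/
def AS3 (f : E n → ℝ) (c : E n → E q) (h : E q → ℝ) (Φlow : ℝ) : Prop :=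
  ∀ x, Φlow ≤ Phi f c h x

/-- At the point `x`, the stochastic gradient `G(x,ξ)` has mean `∇f(x)` and variance at most
`σ²`, where `ξ` has law `P`. -/
structure AS4At [MeasurableSpace Ξ] (P : Measure Ξ) (f : E n → ℝ) (F : E n → Ξ → ℝ) (σ : ℝ)
    (x : E n) : Prop where
  integrable : Integrable (fun s => oracleGrad F x s) P
  unbiased : ∫ s, oracleGrad F x s ∂P = gradient f x
  integrable_sq : Integrable (fun s => ‖oracleGrad F x s - gradient f x‖ ^ 2) P
  variance_le : ∫ s, ‖oracleGrad F x s - gradient f x‖ ^ 2 ∂P ≤ σ ^ 2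

/-- The zeroth-order oracle: for every realization `s`, `F(·,s)` is continuously differentiable
with `Lg`-Lipschitz gradient, and for every input `x` the output `F(x,ξ)` is an unbiased
estimator of `f(x)`. -/
structure AS5 [MeasurableSpace Ξ] (P : Measure Ξ) (f : E n → ℝ) (F : E n → Ξ → ℝ)
    (Lg : ℝ≥0) : Prop where
  measurable : ∀ x, Measurable (F x)
  contDiff : ∀ s, ContDiff ℝ 1 (fun x => F x s)
  lipschitz_grad : ∀ s, LipschitzWith Lg (fun x => oracleGrad F x s)
  integrable : ∀ x, Integrable (F x) P
  unbiased : ∀ x, ∫ s, F x s ∂P = f x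

/-! ### Parameters of the complexity result -/

/-- `L = L_g + L_h L_J`. -/
def stepL (Lg Lh LJ : ℝ≥0) : ℝ := Lg + Lh * LJ

/-- The batch size `m = ⌈min {N̄, max {1, (1/L) √(N̄ / D̃₂)}}⌉`. -/
def batchSize (L D₂ : ℝ) (Nbar : ℕ) : ℕ :=
  ⌈min (Nbar : ℝ) (max 1 (1 / L * √((Nbar : ℝ) / D₂)))⌉₊

/-- The maximum iteration number `N = ⌈N̄ / m⌉`. -/
def maxIter (m Nbar : ℕ) : ℕ := ⌈(Nbar : ℝ) / (m : ℝ)⌉₊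

/-- `C̃₁ = 24 (n + 4) (κ_g² + σ²) √D̃₂`. -/
def constC (n : ℕ) (σ κg D₂ : ℝ) : ℝ := 24 * (n + 4) * (κg ^ 2 + σ ^ 2) * √D₂

/-- The lower bound on the budget `N̄`; `D` is `D_{Φ_h} = Φ_h(x₁) - Φ_h^low`. -/
def budgetBound (n : ℕ) (Lg L σ κg D₁ D₂ D ε : ℝ) : ℝ :=
  max ((16 * D / √D₂ + L * constC n σ κg D₂) ^ 2 / ε ^ 2
      + (104 * L * Lg * D₁ * (n + 4) ^ 3 + 64 * L * D) / ε)
    (1 / (L ^ 2 * D₂))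

/-- With total budget `Nbar`, the algorithm reaches the tolerance `ε` on every problem with the
given constants (`D = Φ_h(x₁) - Φ_h^low`), for every admissible smoothing parameter `μ`:
with `γ_k = 1/L`, the prescribed batch size and output distribution, and as long as
`‖∇f(x_k)‖ ≤ κ_g` along the run,
`𝔼‖g̃ʳ_{μ,R}‖² ≤ ε` and `𝔼‖g̃_R‖² ≤ ε`, and no run makes more than `Nbar` oracle calls.
The moment assumption on the stochastic gradients and the bound on `∇f` are only asked for at
the iterates `x_1, …, x_N`, almost surely. -/
def SolvesWithBudget (n q : ℕ) (Lg Lh LJ : ℝ≥0) (σ κg D₁ D₂ D ε : ℝ) (Nbar : ℕ) : Prop :=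
  ∀ (Ξ : Type u) [MeasurableSpace Ξ] (P : Measure Ξ) [IsProbabilityMeasure P]
    (f : E n → ℝ) (c : E n → E q) (h : E q → ℝ) (F : E n → Ξ → ℝ) (x₁ : E n) (Φlow : ℝ),
    AS1 f c Lg LJ → AS2 h Lh → AS3 f c h Φlow → AS5 P f F Lg → Phi f c h x₁ - Φlow = D →
  ∀ (Ω : Type w) [MeasurableSpace Ω] (Pr : Measure Ω) [IsProbabilityMeasure Pr]
    (ξ : ℕ → ℕ → Ω → Ξ) (v : ℕ → ℕ → Ω → E n) (R : Ω → ℕ) (μ : ℝ)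
    (L : ℝ) (γ : ℕ → ℝ) (m : ℕ → ℕ) (N : ℕ),
    L = stepL Lg Lh LJ →
    (∀ k, γ k = 1 / L) →
    (∀ k, m k = batchSize L D₂ Nbar) →
    N = maxIter (batchSize L D₂ Nbar) Nbar →
    0 < μ → μ ≤ √(D₁ / (Nbar : ℝ)) →
    IsSampling Pr P L γ N ξ v R →
    (∀ k ∈ Finset.Icc 1 N, ∀ᵐ ω ∂Pr, AS4At P f F σ
      (iterate F c h γ m μ x₁ (fun k i => ξ k i ω) (fun k i => v k i ω) k)) →
    (∀ k ∈ Finset.Icc 1 N, ∀ᵐ ω ∂Pr, ‖gradient f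
      (iterate F c h γ m μ x₁ (fun k i => ξ k i ω) (fun k i => v k i ω) k)‖ ≤ κg) →
    (Integrable (fun ω => ‖zoGenGrad F c h γ m μ x₁
        (fun k i => ξ k i ω) (fun k i => v k i ω) (R ω)‖ ^ 2) Pr ∧
      ∫ ω, ‖zoGenGrad F c h γ m μ x₁
        (fun k i => ξ k i ω) (fun k i => v k i ω) (R ω)‖ ^ 2 ∂Pr ≤ ε) ∧
    (Integrable (fun ω => ‖trueGenGrad f F c h γ m μ x₁
        (fun k i => ξ k i ω) (fun k i => v k i ω) (R ω)‖ ^ 2) Pr ∧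
      ∫ ω, ‖trueGenGrad f F c h γ m μ x₁
        (fun k i => ξ k i ω) (fun k i => v k i ω) (R ω)‖ ^ 2 ∂Pr ≤ ε) ∧
    (∀ ω, szoCalls m (R ω) ≤ Nbar)

/-! ### The argmin is well defined -/

theorem existsUnique_isMinOn_psi (c : E n → E q) {h : E q → ℝ} {Lh : ℝ≥0} (hh : AS2 h Lh)
    {γ : ℝ} (hγ : 0 < γ) (x g : E n) :
    ∃! u, IsMinOn (psi c h γ x g) Set.univ u := by
  set A := fderiv ℝ c x
  have hcont : Continuous (psi c h γ x g) := by
    have := hh.lipschitz.continuous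
    unfold psi
    fun_prop
  have hconv : ConvexOn ℝ Set.univ fun u : E n =>
      inner ℝ g (u - x) + h (c x + A (u - x)) := by
    refine ConvexOn.add ⟨convex_univ, fun a _ b _ s t _ _ hst => le_of_eq ?_⟩
      ⟨convex_univ, fun a _ b _ s t hs ht hst => ?_⟩
    · have : s • a + t • b - x = s • (a - x) + t • (b - x) := by
        rw [smul_sub, smul_sub]
        have : x = s • x + t • x := by rw [← add_smul, hst, one_smul]
        nth_rewrite 1 [this]; abel
      simp only [this, inner_add_right, inner_smul_right, smul_eq_mul]
    · have e : c x + A (s • a + t • b - x) =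
          s • (c x + A (a - x)) + t • (c x + A (b - x)) := by
        have h1 : s • a + t • b - x = s • (a - x) + t • (b - x) := by
          rw [smul_sub, smul_sub]
          have : x = s • x + t • x := by rw [← add_smul, hst, one_smul]
          nth_rewrite 1 [this]; abel
        have h2 : c x = s • c x + t • c x := by rw [← add_smul, hst, one_smul]
        rw [h1, map_add, map_smul, map_smul, smul_add, smul_add]
        nth_rewrite 1 [h2]; abel
      simp only [e]
      exact hh.convex.2 (Set.mem_univ _) (Set.mem_univ _) hs ht hst
  have hstrict : StrictConvexOn ℝ Set.univ (psi c h γ x g) := by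
    have hs : StrongConvexOn Set.univ (1 / γ) (psi c h γ x g) := by
      rw [strongConvexOn_iff_convex]
      have hl : ConvexOn ℝ Set.univ fun u : E n =>
          1 / (2 * γ) * ‖x‖ ^ 2 - (1 / γ) * inner ℝ x u := by
        refine ⟨convex_univ, fun a _ b _ s t _ _ hst => le_of_eq ?_⟩
        simp only [inner_add_right, inner_smul_right, smul_eq_mul]
        linear_combination (-(1 / (2 * γ) * ‖x‖ ^ 2)) * hst
      refine (hconv.add hl).congr fun u _ => ?_
      simp only [psi, Pi.add_apply]
      rw [norm_sub_sq_real, real_inner_comm u x]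
      field_simp
      ring
    exact hs.strictConvexOn (by positivity)
  have hlow : ∀ u, h (c x) - (Lh * ‖A‖ + ‖g‖) * ‖u - x‖ + 1 / (2 * γ) * ‖u - x‖ ^ 2
      ≤ psi c h γ x g u := by
    intro u
    have h1 := abs_le.1 (abs_real_inner_le_norm g (u - x))
    have h2 := hh.lipschitz.dist_le_mul (c x + A (u - x)) (c x)
    rw [Real.dist_eq, dist_eq_norm, add_sub_cancel_left] at h2
    have h3 := (abs_le.1 h2).1
    have h4 : (Lh : ℝ) * ‖A (u - x)‖ ≤ Lh * (‖A‖ * ‖u - x‖) := by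
      gcongr; exact A.le_opNorm _
    unfold psi
    nlinarith [h1.1]
  have htend : Filter.Tendsto (psi c h γ x g) (Filter.cocompact _) Filter.atTop := by
    refine Filter.tendsto_atTop_mono hlow ?_
    have hn : Filter.Tendsto (fun u : E n => ‖u - x‖) (Filter.cocompact _) Filter.atTop := by
      refine Filter.tendsto_atTop_mono (fun u => norm_sub_norm_le u x) ?_
      exact Filter.tendsto_atTop_add_const_right _ _ tendsto_norm_cocompact_atTop
    have hq : Filter.Tendsto (fun r : ℝ => h (c x) +
        r * (1 / (2 * γ) * r + -(Lh * ‖A‖ + ‖g‖))) Filter.atTop Filter.atTop := by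
      refine Filter.tendsto_atTop_add_const_left _ _
        (Filter.tendsto_id.atTop_mul_atTop₀ ?_)
      exact Filter.tendsto_atTop_add_const_right _ _
        (Filter.tendsto_id.const_mul_atTop (by positivity))
    refine (hq.comp hn).congr fun u => ?_
    simp only [Function.comp]
    ring
  obtain ⟨u, hu⟩ := hcont.exists_forall_le htend
  have hu' : IsMinOn (psi c h γ x g) Set.univ u := isMinOn_iff.2 fun y _ => hu y
  exact ⟨u, hu', fun y hy => hstrict.eq_of_isMinOn hy hu' trivial trivial⟩

theorem proxPoint_isMinOn (c : E n → E q) {h : E q → ℝ} {Lh : ℝ≥0} (hh : AS2 h Lh)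
    {γ : ℝ} (hγ : 0 < γ) (x g : E n) :
    IsMinOn (psi c h γ x g) Set.univ (proxPoint c h γ x g) :=
  Classical.epsilon_spec (existsUnique_isMinOn_psi c hh hγ x g).exists

end ZOComposite

end

/-! At `γ = 1/L` a prox step with an inexact gradient `G` gives Φ(x⁺) ≤ Φ(x) − (γ/2)‖r‖² + γ⟨G −
∇f(x), r⟩, where r = P_γ(x,G) (`Phi_proxPoint_le`). The error G − ∇f(x) is a noise ν, centred given
x, plus a bias β that depends on x only. Since r depends on ν, ⟨ν, r⟩ is not centred; but P_γ(x,·)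
is nonexpansive (`norm_genGrad_sub_le`), so r lies within ‖ν‖ of p = P_γ(x, M(x)), where M(x) is the
conditional mean of G, and ⟨p, ν⟩ has mean zero. The noise therefore costs only E‖ν‖², and Young's
inequality absorbs the bias (`step_estimate`). The inequalities telescope over the run, Φ is bounded
below, and `R` is uniform because the stepsizes are equal, so the average over k is the expectation
at the output. Nonexpansiveness also carries the bound from G to ∇f.

The two error sizes come from a Taylor expansion: the two-point estimator is ⟨∇F, v⟩v plus a
remainder of norm at most (L_g μ/2)‖v‖³. The first part has mean ∇f and second moment (n+2) E‖∇F‖²;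
the remainder is controlled by E‖v‖⁶ = n(n+2)(n+4). So the squared bias is of order μ² and the batch
noise of order 1/m (`batchGrad_noise`). With m of order √N̄ and μ² ≤ D₁/N̄, every error term is
O(N̄^(-1/2)) or O(1/N̄), and the lower bound on N̄ pushes their sum below ε (`budget_arith`). -/

namespace ZOComposite

/-! ### Taylor bounds, the prox model and the generalized gradient. -/

variable {n q : ℕ} {Ξ : Type*}

/-- First-order Taylor estimate for a map with Lipschitz derivative. -/
theorem norm_sub_sub_fderiv_le {V W : Type*} [NormedAddCommGroup V] [NormedSpace ℝ V]
    [NormedAddCommGroup W] [NormedSpace ℝ W] {φ : V → W} {K : ℝ≥0} (hd : Differentiable ℝ φ)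
    (hK : LipschitzWith K (fderiv ℝ φ)) (x y : V) :
    ‖φ y - φ x - fderiv ℝ φ x (y - x)‖ ≤ K / 2 * ‖y - x‖ ^ 2 := by
  set d := y - x with hdef
  have hl : ∀ t : ℝ, HasDerivAt (fun t : ℝ => x + t • d) d t := fun t => by
    simpa using ((hasDerivAt_id t).smul_const d).const_add x
  have hg : ∀ t : ℝ, HasDerivAt (fun t : ℝ => φ (x + t • d) - φ x - t • fderiv ℝ φ x d)
      (fderiv ℝ φ (x + t • d) d - fderiv ℝ φ x d) t := fun t => by
    have h1 := ((hd (x + t • d)).hasFDerivAt.comp_hasDerivAt t (hl t)).sub_const (φ x)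
    have h2 := (hasDerivAt_id t).smul_const (fderiv ℝ φ x d)
    exact (h1.sub h2).congr_deriv (by rw [one_smul])
  have hB : ∀ t : ℝ, HasDerivAt (fun t : ℝ => K / 2 * ‖d‖ ^ 2 * t ^ 2)
      (K * ‖d‖ ^ 2 * t) t := fun t => by
    have := ((hasDerivAt_id t).pow 2).const_mul (K / 2 * ‖d‖ ^ 2)
    refine this.congr_deriv ?_
    simp; ring
  -- Mean value inequality on the segment: the Taylor remainder vanishes at t = 0 and its derivative
  -- has norm at most K t ‖d‖².
  have key := image_norm_le_of_norm_deriv_right_le_deriv_boundary (a := 0) (b := 1)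
    (f := fun t : ℝ => φ (x + t • d) - φ x - t • fderiv ℝ φ x d)
    (f' := fun t => fderiv ℝ φ (x + t • d) d - fderiv ℝ φ x d)
    (B := fun t : ℝ => K / 2 * ‖d‖ ^ 2 * t ^ 2) (B' := fun t => K * ‖d‖ ^ 2 * t)
    (fun t _ => (hg t).continuousAt.continuousWithinAt)
    (fun t _ => (hg t).hasDerivWithinAt) (by simp) hB
    (fun t ht => by
      rw [← sub_apply]
      refine (ContinuousLinearMap.le_opNorm _ _).trans ?_
      have := hK.dist_le_mul (x + t • d) x
      rw [dist_eq_norm, dist_eq_norm, add_sub_cancel_left, norm_smul, Real.norm_of_nonneg ht.1]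
        at this
      calc _ ≤ K * (t * ‖d‖) * ‖d‖ := by gcongr
        _ = _ := by ring)
    (Set.right_mem_Icc.2 zero_le_one)
  simpa [hdef] using key

theorem gradient_taylor {φ : E n → ℝ} {K : ℝ≥0} (hd : Differentiable ℝ φ)
    (hK : LipschitzWith K (gradient φ)) (x y : E n) :
    |φ y - φ x - inner ℝ (gradient φ x) (y - x)| ≤ K / 2 * ‖y - x‖ ^ 2 := by
  have hK' : LipschitzWith K (fderiv ℝ φ) := by
    refine LipschitzWith.of_dist_le_mul fun a b => ?_
    have := hK.dist_le_mul a b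
    simpa only [gradient, LinearIsometryEquiv.dist_map] using this
  have := norm_sub_sub_fderiv_le hd hK' x y
  rwa [Real.norm_eq_abs, show fderiv ℝ φ x (y - x) = inner ℝ (gradient φ x) (y - x) from by
    rw [gradient, InnerProductSpace.toDual_symm_apply]] at this

theorem norm_sq_combo {V : Type*} [NormedAddCommGroup V] [InnerProductSpace ℝ V] {a b : ℝ}
    (hab : a + b = 1) (u y : V) :
    ‖a • u + b • y‖ ^ 2 = a * ‖u‖ ^ 2 + b * ‖y‖ ^ 2 - a * b * ‖y - u‖ ^ 2 := by
  rw [norm_add_sq_real, norm_sub_sq_real, norm_smul, norm_smul, mul_pow, mul_pow,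
    inner_smul_left, inner_smul_right, real_inner_comm u y, Real.norm_eq_abs, Real.norm_eq_abs,
    sq_abs, sq_abs]
  obtain rfl : b = 1 - a := by linarith
  simp only [conj_trivial]
  ring

/-- The linear term and `h` along an affine map satisfy plain convexity; the negative term is the
exact defect of the squared norm, `norm_sq_combo`. -/
theorem psi_combo_le (c : E n → E q) {h : E q → ℝ} {Lh : ℝ≥0} (hh : AS2 h Lh) (γ : ℝ)
    (x g u y : E n) {a b : ℝ} (ha : 0 ≤ a) (hb : 0 ≤ b) (hab : a + b = 1) :
    psi c h γ x g (a • u + b • y) ≤ a * psi c h γ x g u + b * psi c h γ x g y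
      - a * b * (1 / (2 * γ) * ‖y - u‖ ^ 2) := by
  have h1 : a • u + b • y - x = a • (u - x) + b • (y - x) := by
    have : x = a • x + b • x := by rw [← add_smul, hab, one_smul]
    rw [smul_sub, smul_sub]; nth_rewrite 1 [this]; abel
  have h2 : c x + fderiv ℝ c x (a • (u - x) + b • (y - x)) =
      a • (c x + fderiv ℝ c x (u - x)) + b • (c x + fderiv ℝ c x (y - x)) := by
    have : c x = a • c x + b • c x := by rw [← add_smul, hab, one_smul]
    rw [map_add, map_smul, map_smul, smul_add, smul_add]; nth_rewrite 1 [this]; abel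
  have h3 := hh.convex.2 (Set.mem_univ (c x + fderiv ℝ c x (u - x)))
    (Set.mem_univ (c x + fderiv ℝ c x (y - x))) ha hb hab
  have h4 := norm_sq_combo hab (u - x) (y - x)
  rw [sub_sub_sub_cancel_right] at h4
  unfold psi
  rw [h1, h2, h4, inner_add_right, inner_smul_right, inner_smul_right]
  simp only [smul_eq_mul] at h3
  linarith

/-- Quadratic growth of the model at its minimizer. -/
theorem psi_proxPoint_add_le (c : E n → E q) {h : E q → ℝ} {Lh : ℝ≥0} (hh : AS2 h Lh)
    {γ : ℝ} (hγ : 0 < γ) (x g y : E n) :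
    psi c h γ x g (proxPoint c h γ x g) + 1 / (2 * γ) * ‖y - proxPoint c h γ x g‖ ^ 2
      ≤ psi c h γ x g y := by
  set u := proxPoint c h γ x g
  set d := 1 / (2 * γ) * ‖y - u‖ ^ 2
  have hmin : ∀ z, psi c h γ x g u ≤ psi c h γ x g z := fun z =>
    isMinOn_iff.1 (proxPoint_isMinOn c hh hγ x g) z (Set.mem_univ z)
  -- Test minimality at (1 − t)u + t y and divide by t; the factor 1 − t disappears as t → 0.
  have key : ∀ t ∈ Set.Ioo (0 : ℝ) 1, psi c h γ x g u + (1 - t) * d ≤ psi c h γ x g y := by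
    intro t ht
    have h1 := (hmin _).trans (psi_combo_le c hh γ x g u y (a := 1 - t) (b := t)
      (by linarith [ht.2]) ht.1.le (by ring))
    have : 0 ≤ t * (psi c h γ x g y - psi c h γ x g u - (1 - t) * d) := by
      simp only [d]; linarith
    linarith [nonneg_of_mul_nonneg_right this ht.1]
  have hlim : Filter.Tendsto (fun t : ℝ => psi c h γ x g u + (1 - t) * d)
      (nhdsWithin 0 (Set.Ioi 0)) (nhds (psi c h γ x g u + (1 - 0) * d)) :=
    (Continuous.tendsto (by fun_prop) 0).mono_left nhdsWithin_le_nhds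
  have := le_of_tendsto hlim (by
    filter_upwards [Ioo_mem_nhdsGT (zero_lt_one' ℝ)] with t ht using key t ht)
  simpa using this

/-- Add the quadratic growth of each model at the minimizer of the other. What remains is the
difference of the two models at two points, which serves both the Lipschitz bound in `g` and joint
continuity. -/
theorem proxPoint_stability (c : E n → E q) {h : E q → ℝ} {Lh : ℝ≥0} (hh : AS2 h Lh)
    {γ : ℝ} (hγ : 0 < γ) (x g x' g' : E n) :
    1 / γ * ‖proxPoint c h γ x' g' - proxPoint c h γ x g‖ ^ 2 ≤
      psi c h γ x' g' (proxPoint c h γ x g) - psi c h γ x g (proxPoint c h γ x g) +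
      (psi c h γ x g (proxPoint c h γ x' g') - psi c h γ x' g' (proxPoint c h γ x' g')) := by
  have h1 := psi_proxPoint_add_le c hh hγ x g (proxPoint c h γ x' g')
  have h2 := psi_proxPoint_add_le c hh hγ x' g' (proxPoint c h γ x g)
  rw [norm_sub_rev] at h2
  have : 1 / γ = 1 / (2 * γ) + 1 / (2 * γ) := by field_simp; norm_num
  rw [this]; linarith

/-- For fixed `x` the models differ by a linear term, so the stability bound reads ‖u' − u‖²/γ ≤ ⟨g'
− g, u − u'⟩; Cauchy–Schwarz finishes. -/
theorem norm_proxPoint_sub_le (c : E n → E q) {h : E q → ℝ} {Lh : ℝ≥0} (hh : AS2 h Lh)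
    {γ : ℝ} (hγ : 0 < γ) (x g g' : E n) :
    ‖proxPoint c h γ x g' - proxPoint c h γ x g‖ ≤ γ * ‖g' - g‖ := by
  set u := proxPoint c h γ x g
  set u' := proxPoint c h γ x g'
  have h1 := proxPoint_stability c hh hγ x g x g'
  have h2 : psi c h γ x g' u - psi c h γ x g u + (psi c h γ x g u' - psi c h γ x g' u') =
      inner ℝ (g' - g) (u - u') := by
    unfold psi; simp only [inner_sub_left, inner_sub_right]; ring
  rw [h2] at h1
  have h3 := h1.trans (real_inner_le_norm _ _)
  rw [norm_sub_rev u u'] at h3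
  rcases (norm_nonneg (u' - u)).eq_or_lt with h0 | h0
  · rw [← h0]; positivity
  · have : (1 / γ * ‖u' - u‖) * ‖u' - u‖ ≤ ‖g' - g‖ * ‖u' - u‖ := by linarith
    have := le_of_mul_le_mul_right this h0
    rwa [one_div, inv_mul_le_iff₀ hγ] at this

theorem norm_genGrad_sub_le (c : E n → E q) {h : E q → ℝ} {Lh : ℝ≥0} (hh : AS2 h Lh)
    {γ : ℝ} (hγ : 0 < γ) (x g g' : E n) :
    ‖genGrad c h γ x g' - genGrad c h γ x g‖ ≤ ‖g' - g‖ := by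
  have := norm_proxPoint_sub_le c hh hγ x g g'
  rw [genGrad, genGrad, ← smul_sub, sub_sub_sub_cancel_left, norm_smul, norm_sub_rev,
    Real.norm_of_nonneg (by positivity), one_div, inv_mul_le_iff₀ hγ]
  exact this

theorem proxPoint_eq_sub_smul_genGrad (c : E n → E q) (h : E q → ℝ) {γ : ℝ} (hγ : γ ≠ 0)
    (x g : E n) : proxPoint c h γ x g = x - γ • genGrad c h γ x g := by
  rw [genGrad, smul_smul, mul_one_div_cancel hγ, one_smul, sub_sub_cancel]

/-- Joint continuity is what makes the iterates measurable. Stability gives d² ≤ γ(e₁ d + e₂) for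
the displacement d, with e₁ and e₂ continuous and zero at the base point. -/
theorem continuous_proxPoint {c : E n → E q} (hc : ContDiff ℝ 1 c) {h : E q → ℝ} {Lh : ℝ≥0}
    (hh : AS2 h Lh) {γ : ℝ} (hγ : 0 < γ) :
    Continuous fun p : E n × E n => proxPoint c h γ p.1 p.2 := by
  rw [continuous_iff_continuousAt]
  rintro ⟨x, g⟩
  set u := proxPoint c h γ x g with hu
  have hJ : Continuous (fderiv ℝ c) := hc.continuous_fderiv (by norm_num)
  have hc0 : Continuous c := hc.continuous
  let e₁ : E n × E n → ℝ := fun p =>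
    ‖p.2 - g‖ + 1 / γ * ‖p.1 - x‖ + Lh * ‖fderiv ℝ c p.1 - fderiv ℝ c x‖
  let e₂ : E n × E n → ℝ := fun p => 2 * Lh * (‖c p.1 - c x‖ +
    ‖fderiv ℝ c p.1 - fderiv ℝ c x‖ * ‖u - x‖ + ‖fderiv ℝ c p.1‖ * ‖p.1 - x‖)
  have hb : ∀ p : E n × E n, ‖proxPoint c h γ p.1 p.2 - u‖ ^ 2 ≤
      γ ^ 2 * e₁ p ^ 2 + 2 * γ * e₂ p := by
    rintro ⟨x', g'⟩
    set u' := proxPoint c h γ x' g'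
    set d := ‖u' - u‖
    have h1 := proxPoint_stability c hh hγ x g x' g'
    have hdiff : ∀ y, |h (c x' + fderiv ℝ c x' (y - x')) - h (c x + fderiv ℝ c x (y - x))| ≤
        Lh * (‖c x' - c x‖ + ‖fderiv ℝ c x' - fderiv ℝ c x‖ * ‖y - x‖ +
          ‖fderiv ℝ c x'‖ * ‖x' - x‖) := by
      intro y
      have := hh.lipschitz.dist_le_mul (c x' + fderiv ℝ c x' (y - x')) (c x + fderiv ℝ c x (y - x))
      rw [Real.dist_eq, dist_eq_norm] at this
      refine this.trans ?_
      gcongr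
      have e : c x' + fderiv ℝ c x' (y - x') - (c x + fderiv ℝ c x (y - x)) =
          (c x' - c x) + (fderiv ℝ c x' - fderiv ℝ c x) (y - x) - fderiv ℝ c x' (x' - x) := by
        simp only [sub_apply, map_sub]; abel
      rw [e]
      refine (norm_sub_le _ _).trans (add_le_add ((norm_add_le _ _).trans
        (add_le_add le_rfl ?_)) ?_) <;> exact ContinuousLinearMap.le_opNorm _ _
    have hd1 := (abs_le.1 (hdiff u)).2
    have hd2 := (abs_le.1 (hdiff u')).1
    have hux : ‖u' - x‖ ≤ d + ‖u - x‖ := by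
      have := norm_add_le (u' - u) (u - x); rwa [sub_add_sub_cancel] at this
    have h2 : psi c h γ x' g' u - psi c h γ x g u + (psi c h γ x g u' - psi c h γ x' g' u') =
        inner ℝ (g' - g) (u - u') - 1 / γ * inner ℝ (x' - x) (u - u') +
        (h (c x' + fderiv ℝ c x' (u - x')) - h (c x + fderiv ℝ c x (u - x))) -
        (h (c x' + fderiv ℝ c x' (u' - x')) - h (c x + fderiv ℝ c x (u' - x))) := by
      unfold psi
      simp only [norm_sub_sq_real, inner_sub_left, inner_sub_right]
      rw [real_inner_comm u x', real_inner_comm u x, real_inner_comm u' x', real_inner_comm u' x]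
      field_simp
      ring
    have h3 := real_inner_le_norm (g' - g) (u - u')
    have h4 := (abs_le.1 (abs_real_inner_le_norm (x' - x) (u - u'))).1
    rw [norm_sub_rev u u'] at h3 h4
    have h5 : 1 / γ * (-(‖x' - x‖ * d)) ≤ 1 / γ * inner ℝ (x' - x) (u - u') := by gcongr
    have h6 : (Lh : ℝ) * (‖fderiv ℝ c x' - fderiv ℝ c x‖ * ‖u' - x‖) ≤
        Lh * (‖fderiv ℝ c x' - fderiv ℝ c x‖ * (d + ‖u - x‖)) := by gcongr
    have h7 : 1 / γ * d ^ 2 ≤ e₁ (x', g') * d + e₂ (x', g') := by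
      rw [h2] at h1; simp only [e₁, e₂]; linarith
    have h8 : d ^ 2 ≤ γ * (e₁ (x', g') * d + e₂ (x', g')) := by
      rwa [one_div, inv_mul_le_iff₀ hγ] at h7
    -- Young's inequality γ e₁ d ≤ d²/2 + γ² e₁²/2, with half of d² absorbed on the left.
    nlinarith [sq_nonneg (d - γ * e₁ (x', g'))]
  have he₁ : Continuous e₁ := by fun_prop
  have he₂ : Continuous e₂ := by fun_prop
  have hlim : Filter.Tendsto (fun p => γ ^ 2 * e₁ p ^ 2 + 2 * γ * e₂ p) (nhds (x, g)) (nhds 0) := by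
    have : Continuous fun p => γ ^ 2 * e₁ p ^ 2 + 2 * γ * e₂ p := by fun_prop
    have := this.tendsto (x, g)
    simpa [e₁, e₂] using this
  have hsq := squeeze_zero (fun p => sq_nonneg _) hb hlim
  have hn := hsq.sqrt
  simp only [Real.sqrt_sq (norm_nonneg _), Real.sqrt_zero] at hn
  exact tendsto_iff_norm_sub_tendsto_zero.2 hn

/-- Sufficient decrease of the composite objective along an inexact prox step. -/
theorem Phi_proxPoint_le {f : E n → ℝ} {c : E n → E q} {h : E q → ℝ} {Lg Lh LJ : ℝ≥0}
    (h1 : AS1 f c Lg LJ) (hh : AS2 h Lh) {γ : ℝ} (hγ : 0 < γ) (x g : E n) :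
    Phi f c h (proxPoint c h γ x g) ≤ Phi f c h x
      - (γ - stepL Lg Lh LJ * γ ^ 2 / 2) * ‖genGrad c h γ x g‖ ^ 2
      + γ * inner ℝ (g - gradient f x) (genGrad c h γ x g) := by
  have hux := proxPoint_eq_sub_smul_genGrad c h hγ.ne' x g
  set u := proxPoint c h γ x g with hu
  set p := genGrad c h γ x g
  have hd : u - x = -(γ • p) := by rw [hux]; abel
  have hn : ‖u - x‖ ^ 2 = γ ^ 2 * ‖p‖ ^ 2 := by
    rw [hd, norm_neg, norm_smul, mul_pow, Real.norm_eq_abs, sq_abs]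
  have a1 := (abs_le.1 (gradient_taylor (h1.contDiff_f.differentiable (by norm_num))
    h1.lipschitz_grad x u)).2
  have a2 := norm_sub_sub_fderiv_le (h1.contDiff_c.differentiable (by norm_num))
    h1.lipschitz_jac x u
  have a3 : h (c u) - h (c x + fderiv ℝ c x (u - x)) ≤ Lh * (LJ / 2 * ‖u - x‖ ^ 2) := by
    have := hh.lipschitz.dist_le_mul (c u) (c x + fderiv ℝ c x (u - x))
    rw [Real.dist_eq, dist_eq_norm, ← sub_sub] at this
    refine (le_abs_self _).trans (this.trans ?_)
    gcongr
  -- Comparing with the point `x`, where the model equals `h (c x)`, uses the growth term as well: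
  -- it doubles the quadratic and yields the full coefficient γ on ‖p‖².
  have a4 := psi_proxPoint_add_le c hh hγ x g x
  rw [← hu, norm_sub_rev x u] at a4
  simp only [psi, sub_self, inner_zero_right, map_zero, add_zero, norm_zero, zero_add] at a4
  have a5 : inner ℝ (g - gradient f x) p * γ =
      inner ℝ (gradient f x) (u - x) - inner ℝ g (u - x) := by
    rw [hd, inner_sub_left, inner_neg_right, inner_neg_right, inner_smul_right, inner_smul_right]
    ring
  have a6 : 1 / (2 * γ) * ‖u - x‖ ^ 2 = γ / 2 * ‖p‖ ^ 2 := by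
    rw [hn]; field_simp
  rw [a6] at a4
  rw [hn] at a1 a3
  unfold Phi stepL
  nlinarith
-- Gaussian moments.
-- M(t) = exp(w t²/2) is the moment generating function of N(0,w) and satisfies M' = w t M;
-- differentiate this identity k + 1 times. At t = 0 it becomes the recursion for the moments;
-- general t is needed for the induction.
theorem iteratedDeriv_exp_sq (w : ℝ) (k : ℕ) (t : ℝ) :
    iteratedDeriv (k + 2) (fun t : ℝ => Real.exp (w * t ^ 2 / 2)) t =
      w * (t * iteratedDeriv (k + 1) (fun t : ℝ => Real.exp (w * t ^ 2 / 2)) t +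
        (k + 1) * iteratedDeriv k (fun t : ℝ => Real.exp (w * t ^ 2 / 2)) t) := by
  set M := fun t : ℝ => Real.exp (w * t ^ 2 / 2) with hM
  have hsm : ContDiff ℝ ⊤ M := by fun_prop
  have hd : ∀ k t, HasDerivAt (iteratedDeriv k M) (iteratedDeriv (k + 1) M t) t := fun k t => by
    rw [iteratedDeriv_succ]
    exact ((hsm.differentiable_iteratedDeriv k (by exact WithTop.coe_lt_top _)) t).hasDerivAt
  have h1 : iteratedDeriv 1 M = fun t => w * (t * M t) := by
    ext t
    have h1 : HasDerivAt (fun t : ℝ => w * t ^ 2 / 2) (w * t) t :=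
      (((hasDerivAt_id' t).fun_pow 2).const_mul w).div_const 2 |>.congr_deriv (by simp; ring)
    rw [iteratedDeriv_one, hM, h1.exp.deriv]; ring
  induction k generalizing t with
  | zero =>
    have h2 : HasDerivAt (iteratedDeriv 1 M) (w * (1 * M t + t * iteratedDeriv 1 M t)) t := by
      have h3 : HasDerivAt M (iteratedDeriv 1 M t) t := by simpa using hd 0 t
      rw [h1] at h3 ⊢
      exact ((hasDerivAt_id' t).fun_mul h3).const_mul w
    rw [(hd 1 t).unique h2]
    simp only [zero_add, Nat.cast_zero, iteratedDeriv_zero]; ring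
  | succ k ih =>
    have h2 : HasDerivAt (iteratedDeriv (k + 2) M) (w * ((1 * iteratedDeriv (k + 1) M t +
        t * iteratedDeriv (k + 2) M t) + (k + 1) * iteratedDeriv (k + 1) M t)) t := by
      rw [funext ih]
      exact ((((hasDerivAt_id' t).fun_mul (hd (k + 1) t)).fun_add
        ((hd k t).const_mul (k + 1 : ℝ))).const_mul w).congr_deriv (by rw [ih])
    rw [(hd (k + 2) t).unique h2]
    push_cast; ring

theorem integral_pow_add_two_gaussianReal (w : ℝ≥0) (k : ℕ) :
    ∫ x, x ^ (k + 2) ∂(gaussianReal 0 w) = w * (k + 1) * ∫ x, x ^ k ∂(gaussianReal 0 w) := by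
  have h0 := fun k => iteratedDeriv_mgf_zero (X := fun x : ℝ => x) (μ := gaussianReal 0 w)
    (by simp) k
  have h1 := iteratedDeriv_exp_sq w k 0
  rw [mgf_fun_id_gaussianReal] at h0
  simp only [zero_mul, zero_add] at h0 h1
  rw [h0, h0] at h1
  simpa [mul_assoc] using h1

theorem integral_sq_gaussianReal (w : ℝ≥0) :
    ∫ x, x ^ 2 ∂(gaussianReal 0 w) = (w : ℝ) := by
  simpa using integral_pow_add_two_gaussianReal w 0

theorem integral_pow_four_gaussianReal (w : ℝ≥0) :
    ∫ x, x ^ 4 ∂(gaussianReal 0 w) = 3 * (w : ℝ) ^ 2 := by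
  rw [integral_pow_add_two_gaussianReal w 2, integral_sq_gaussianReal]; push_cast; ring

theorem integral_pow_six_gaussianReal (w : ℝ≥0) :
    ∫ x, x ^ 6 ∂(gaussianReal 0 w) = 15 * (w : ℝ) ^ 3 := by
  rw [integral_pow_add_two_gaussianReal w 4, integral_pow_four_gaussianReal]; push_cast; ring

theorem integrable_pow_gaussianReal (w : ℝ≥0) (k : ℕ) :
    Integrable (fun x : ℝ => x ^ k) (gaussianReal 0 w) := by
  have := (memLp_id_gaussianReal (μ := 0) (v := w) k).integrable_norm_pow' 
  exact (integrable_norm_iff (by fun_prop)).1 (by simpa using this)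

theorem map_inner_stdGaussian (a : E n) :
    (stdGaussian (E n)).map (fun v => inner ℝ a v) = gaussianReal 0 (‖a‖₊ ^ 2) := by
  have := IsGaussian.map_eq_gaussianReal (μ := stdGaussian (E n)) (innerSL ℝ a)
  rw [variance_dual_stdGaussian, integral_strongDual_stdGaussian] at this
  convert this using 2
  · ext v; simp
  rw [innerSL_apply_norm, ← Real.toNNReal_coe (r := ‖a‖₊ ^ 2)]
  simp

theorem integral_inner_pow_four (a : E n) :
    ∫ v, (inner ℝ a v) ^ 4 ∂(stdGaussian (E n)) = 3 * ‖a‖ ^ 4 := by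
  have h := integral_pow_four_gaussianReal (‖a‖₊ ^ 2)
  rw [← map_inner_stdGaussian, integral_map (by fun_prop) (by fun_prop)] at h
  rw [h]; simp; ring

theorem integral_inner_sq (a : E n) :
    ∫ v, (inner ℝ a v) ^ 2 ∂(stdGaussian (E n)) = ‖a‖ ^ 2 := by
  have h := integral_sq_gaussianReal (‖a‖₊ ^ 2)
  rw [← map_inner_stdGaussian, integral_map (by fun_prop) (by fun_prop)] at h
  rw [h]; simp

theorem integrable_norm_pow_stdGaussian (k : ℕ) :
    Integrable (fun v => ‖v‖ ^ k) (stdGaussian (E n)) := by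
  simpa using (IsGaussian.memLp_id (stdGaussian (E n)) k (by simp)).integrable_norm_pow'

/-- A continuous function of polynomial growth is integrable for the Gaussian law. -/
theorem integrable_stdGaussian_of_norm_le {W : Type*} [NormedAddCommGroup W] {φ : E n → W}
    (hφ : AEStronglyMeasurable φ (stdGaussian (E n))) {C : ℝ} {k : ℕ} (h : ∀ v, ‖φ v‖ ≤ C * ‖v‖ ^ k) :
    Integrable φ (stdGaussian (E n)) :=
  ((integrable_norm_pow_stdGaussian k).const_mul C).mono' hφ (Filter.Eventually.of_forall h)

theorem norm_inner_pow_mul_le (a v : E n) (j k : ℕ) :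
    ‖(inner ℝ a v) ^ j * ‖v‖ ^ k‖ ≤ ‖a‖ ^ j * ‖v‖ ^ (j + k) := by
  rw [norm_mul, norm_pow, norm_pow, norm_norm, pow_add, ← mul_assoc, ← mul_pow]
  gcongr
  exact norm_inner_le_norm a v

theorem integrable_inner_pow_mul (a : E n) (j k : ℕ) :
    Integrable (fun v => (inner ℝ a v) ^ j * ‖v‖ ^ k) (stdGaussian (E n)) :=
  integrable_stdGaussian_of_norm_le (by fun_prop) (norm_inner_pow_mul_le a · j k)

theorem integrable_inner_pow (a : E n) (j : ℕ) :
    Integrable (fun v => (inner ℝ a v) ^ j) (stdGaussian (E n)) := by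
  simpa using integrable_inner_pow_mul a j 0

/-- Polarization of the fourth moment: only the one-dimensional laws of ⟨a, v⟩, ⟨b, v⟩ and ⟨a ± b,
v⟩ enter. -/
theorem integral_inner_sq_mul_inner_sq (a b : E n) :
    ∫ v, (inner ℝ a v) ^ 2 * (inner ℝ b v) ^ 2 ∂(stdGaussian (E n)) =
      ‖a‖ ^ 2 * ‖b‖ ^ 2 + 2 * (inner ℝ a b) ^ 2 := by
  have e : ∀ v : E n, (inner ℝ a v) ^ 2 * (inner ℝ b v) ^ 2 =
      1 / 12 * ((inner ℝ (a + b) v) ^ 4 + (inner ℝ (a - b) v) ^ 4) -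
      1 / 6 * ((inner ℝ a v) ^ 4 + (inner ℝ b v) ^ 4) := fun v => by
    rw [inner_add_left, inner_sub_left]; ring
  simp_rw [e]
  have i := fun u : E n => integrable_inner_pow u 4
  rw [integral_sub (((i _).fun_add (i _)).const_mul _) (((i _).fun_add (i _)).const_mul _),
    integral_const_mul, integral_const_mul, integral_add (i _) (i _), integral_add (i _) (i _)]
  simp only [integral_inner_pow_four]
  have e1 : ‖a + b‖ ^ 4 = (‖a‖ ^ 2 + 2 * inner ℝ a b + ‖b‖ ^ 2) ^ 2 := by
    rw [← norm_add_sq_real]; ring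
  have e2 : ‖a - b‖ ^ 4 = (‖a‖ ^ 2 - 2 * inner ℝ a b + ‖b‖ ^ 2) ^ 2 := by
    rw [← norm_sub_sq_real]; ring
  rw [e1, e2]; ring

/-- Expanding ‖v‖² in an orthonormal basis, direction bᵢ contributes ‖a‖² + 2⟨a, bᵢ⟩²; Parseval sums
the second terms to 2‖a‖². -/
theorem integral_inner_sq_mul_norm_sq (a : E n) :
    ∫ v, (inner ℝ a v) ^ 2 * ‖v‖ ^ 2 ∂(stdGaussian (E n)) = (n + 2) * ‖a‖ ^ 2 := by
  set b := EuclideanSpace.basisFun (Fin n) ℝ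
  have e : ∀ v : E n, (inner ℝ a v) ^ 2 * ‖v‖ ^ 2 =
      ∑ i, (inner ℝ a v) ^ 2 * (inner ℝ (b i) v) ^ 2 := fun v => by
    rw [← Finset.mul_sum, b.sum_sq_inner_right]
  simp_rw [e]
  have hi : ∀ i, Integrable (fun v => (inner ℝ a v) ^ 2 * (inner ℝ (b i) v) ^ 2)
      (stdGaussian (E n)) := fun i => by
    refine (integrable_inner_pow_mul a 2 2).mono (by fun_prop) (.of_forall fun v => ?_)
    rw [norm_mul, norm_mul, norm_pow (inner ℝ (b i) v), norm_pow ‖v‖, norm_norm]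
    gcongr
    have := norm_inner_le_norm (𝕜 := ℝ) (b i) v
    rwa [b.norm_eq_one, one_mul] at this
  rw [integral_finsetSum _ fun i _ => hi i]
  simp_rw [integral_inner_sq_mul_inner_sq, b.norm_eq_one]
  rw [Finset.sum_add_distrib, ← Finset.mul_sum, ← Finset.mul_sum, b.sum_sq_inner_left]
  simp; ring

theorem integral_inner_mul_inner (a b : E n) :
    ∫ v, inner ℝ a v * inner ℝ b v ∂(stdGaussian (E n)) = inner ℝ a b := by
  have e : ∀ v : E n, inner ℝ a v * inner ℝ b v =
      1 / 4 * ((inner ℝ (a + b) v) ^ 2 - (inner ℝ (a - b) v) ^ 2) := fun v => by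
    rw [inner_add_left, inner_sub_left]; ring
  simp_rw [e]
  have i := fun u : E n => integrable_inner_pow u 2
  rw [integral_const_mul, integral_sub (i _) (i _), integral_inner_sq, integral_inner_sq,
    norm_add_sq_real, norm_sub_sq_real]
  ring

theorem integrable_inner_smul (a : E n) :
    Integrable (fun v => inner ℝ a v • v) (stdGaussian (E n)) := by
  refine integrable_stdGaussian_of_norm_le (C := ‖a‖) (k := 2) (by fun_prop) fun v => ?_
  rw [norm_smul, pow_two, ← mul_assoc]
  gcongr
  exact norm_inner_le_norm a v

theorem integral_inner_smul (a : E n) :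
    ∫ v, inner ℝ a v • v ∂(stdGaussian (E n)) = a := by
  refine ext_inner_left ℝ fun b => ?_
  rw [← integral_inner (integrable_inner_smul a)]
  simp_rw [inner_smul_right]
  rw [integral_inner_mul_inner, real_inner_comm]

/-- Moments of a sum of squares of independent standard Gaussians. -/
theorem moments_sum_sq {Ω ι : Type*} [MeasurableSpace Ω] {Pr : Measure Ω} [IsProbabilityMeasure Pr]
    {X : ι → Ω → ℝ} (hm : ∀ i, Measurable (X i)) (hX : iIndepFun X Pr)
    (hl : ∀ i, Pr.map (X i) = gaussianReal 0 1) (s : Finset ι) :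
    (∀ k : ℕ, k ≤ 3 → Integrable (fun ω => (∑ i ∈ s, X i ω ^ 2) ^ k) Pr) ∧
    ∫ ω, (∑ i ∈ s, X i ω ^ 2) ∂Pr = s.card ∧
    ∫ ω, (∑ i ∈ s, X i ω ^ 2) ^ 2 ∂Pr = s.card * (s.card + 2) ∧
    ∫ ω, (∑ i ∈ s, X i ω ^ 2) ^ 3 ∂Pr = s.card * (s.card + 2) * (s.card + 4) := by
  classical
  induction s using Finset.induction_on with
  | empty => simp
  | insert a s ha ih =>
    obtain ⟨ii, i1, i2, i3⟩ := ih
    have hY : ∀ k : ℕ, Integrable (fun ω => (X a ω ^ 2) ^ k) Pr := fun k => by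
      have := integrable_pow_gaussianReal 1 (2 * k)
      rw [← hl a, integrable_map_measure (by fun_prop) (hm a).aemeasurable] at this
      simpa [Function.comp_def, pow_mul] using this
    have hE : ∀ k : ℕ, ∫ ω, (X a ω ^ 2) ^ k ∂Pr = ∫ x, x ^ (2 * k) ∂(gaussianReal 0 1) := fun k => by
      rw [← hl a, integral_map (hm a).aemeasurable (by fun_prop)]; simp [pow_mul]
    have hi : IndepFun (fun ω => ∑ i ∈ s, X i ω ^ 2) (fun ω => X a ω ^ 2) Pr := by
      have := (hX.comp (fun _ x => x ^ 2) (fun _ => by fun_prop)).indepFun_finsetSum_of_notMem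
        (fun i => by fun_prop) ha
      convert this using 1
      · ext ω; simp
      · rfl
    have hp : ∀ j k : ℕ, IndepFun (fun ω => (∑ i ∈ s, X i ω ^ 2) ^ j)
        (fun ω => (X a ω ^ 2) ^ k) Pr := fun j k =>
      hi.comp (φ := fun x => x ^ j) (ψ := fun x => x ^ k) (by fun_prop) (by fun_prop)
    have hpi : ∀ j k : ℕ, j ≤ 3 → Integrable (fun ω => (∑ i ∈ s, X i ω ^ 2) ^ j *
        (X a ω ^ 2) ^ k) Pr := fun j k hj => (hp j k).integrable_mul (ii j hj) (hY k)
    have hpe : ∀ j k : ℕ, j ≤ 3 → ∫ ω, (∑ i ∈ s, X i ω ^ 2) ^ j * (X a ω ^ 2) ^ k ∂Pr =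
        (∫ ω, (∑ i ∈ s, X i ω ^ 2) ^ j ∂Pr) * ∫ ω, (X a ω ^ 2) ^ k ∂Pr := fun j k hj =>
      (hp j k).integral_fun_mul_eq_mul_integral (ii j hj).1 (hY k).1
    have e1 : ∀ ω, ∑ i ∈ insert a s, X i ω ^ 2 = X a ω ^ 2 + ∑ i ∈ s, X i ω ^ 2 := fun ω =>
      Finset.sum_insert ha
    -- Binomial expansion: the new square is independent of the old sum, so each mixed moment
    -- factors into a known moment of either one.
    have e2 : ∀ k : ℕ, (fun ω => (∑ i ∈ insert a s, X i ω ^ 2) ^ k) = fun ω =>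
        ∑ j ∈ Finset.range (k + 1), (∑ i ∈ s, X i ω ^ 2) ^ j * (X a ω ^ 2) ^ (k - j) *
          (k.choose j : ℝ) := fun k => by
      ext ω; rw [e1, add_comm, add_pow]
    have e3 : ∀ k : ℕ, k ≤ 3 → ∫ ω, (∑ i ∈ insert a s, X i ω ^ 2) ^ k ∂Pr =
        ∑ j ∈ Finset.range (k + 1), (∫ ω, (∑ i ∈ s, X i ω ^ 2) ^ j ∂Pr) *
          (∫ x, x ^ (2 * (k - j)) ∂(gaussianReal 0 1)) * (k.choose j : ℝ) := fun k hk => by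
      rw [e2, integral_finsetSum]
      · refine Finset.sum_congr rfl fun j hj => ?_
        rw [integral_mul_const, hpe j _ (by simp at hj; omega), hE]
      · intro j hj
        exact (hpi j _ (by simp at hj; omega)).mul_const _
    have m2 := integral_sq_gaussianReal 1
    have m4 := integral_pow_four_gaussianReal 1
    have m6 := integral_pow_six_gaussianReal 1
    refine ⟨fun k hk => ?_, ?_, ?_, ?_⟩
    · rw [e2]
      refine integrable_finsetSum _ fun j hj => ?_
      exact (hpi j _ (by simp at hj; omega)).mul_const _
    · have := e3 1 (by norm_num)
      simp only [pow_one] at this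
      rw [this, Finset.card_insert_of_notMem ha]
      simp [Finset.sum_range_succ, m2, i1]; ring
    · rw [e3 2 (by norm_num), Finset.card_insert_of_notMem ha]
      simp [Finset.sum_range_succ, m2, m4, i1, i2]; ring
    · rw [e3 3 (by norm_num), Finset.card_insert_of_notMem ha]
      simp [Finset.sum_range_succ, m2, m4, m6, i1, i2, i3, Nat.choose]; ring

theorem integral_norm_pow_six :
    ∫ v, ‖v‖ ^ 6 ∂(stdGaussian (E n)) = n * (n + 2) * (n + 4) := by
  rw [← map_pi_eq_stdGaussian, integral_map (by fun_prop) (by fun_prop)]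
  have h := (moments_sum_sq (Pr := Measure.pi (fun _ : Fin n => gaussianReal 0 1))
    (X := fun i x => x i) (fun i => by fun_prop)
    (iIndepFun_pi (X := fun _ x => x) (fun i => by fun_prop))
    (fun i => (measurePreserving_eval _ i).map_eq) Finset.univ).2.2.2
  simp only [Finset.card_univ, Fintype.card_fin] at h
  rw [← h]
  refine integral_congr_ae (.of_forall fun x => ?_)
  simp only
  rw [show (6 : ℕ) = 2 * 3 from rfl, pow_mul, EuclideanSpace.real_norm_sq_eq]

/-! ### Second moments, and bias and size of the two-point estimator. -/

section SecondMoment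

variable {Ω V : Type*} [MeasurableSpace Ω] {Pr : Measure Ω} [IsProbabilityMeasure Pr]
  [NormedAddCommGroup V] [InnerProductSpace ℝ V] [CompleteSpace V]

theorem integral_norm_sub_integral_sq {X : Ω → V} (hX : MemLp X 2 Pr) :
    ∫ ω, ‖X ω - ∫ ω', X ω' ∂Pr‖ ^ 2 ∂Pr = ∫ ω, ‖X ω‖ ^ 2 ∂Pr - ‖∫ ω, X ω ∂Pr‖ ^ 2 := by
  set m := ∫ ω, X ω ∂Pr
  have hi : Integrable X Pr := hX.integrable (by norm_num)
  have hin : Integrable (fun ω => 2 * inner ℝ m (X ω)) Pr := (hi.const_inner m).const_mul 2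
  have e : ∀ ω, ‖X ω - m‖ ^ 2 = ‖X ω‖ ^ 2 - 2 * inner ℝ m (X ω) + ‖m‖ ^ 2 := fun ω => by
    rw [norm_sub_sq_real, real_inner_comm]
  simp_rw [e]
  have hsub : Integrable (fun ω => ‖X ω‖ ^ 2 - 2 * inner ℝ m (X ω)) Pr :=
    hX.integrable_norm_pow'.sub hin
  rw [integral_add hsub (integrable_const _),
    integral_sub hX.integrable_norm_pow' hin, integral_const_mul, integral_inner hi,
    real_inner_self_eq_norm_sq]
  simp; ring

theorem norm_integral_sq_le {X : Ω → V} (hX : MemLp X 2 Pr) :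
    ‖∫ ω, X ω ∂Pr‖ ^ 2 ≤ ∫ ω, ‖X ω‖ ^ 2 ∂Pr := by
  have h := integral_norm_sub_integral_sq hX
  have : 0 ≤ ∫ ω, ‖X ω - ∫ ω', X ω' ∂Pr‖ ^ 2 ∂Pr := integral_nonneg fun _ => sq_nonneg _
  linarith

end SecondMoment

/-- Bound for the second moment of the two-point estimator. -/
noncomputable def momentBound (n : ℕ) (Lg μ σ κg : ℝ) : ℝ :=
  Lg ^ 2 * μ ^ 2 / 2 * (n * (n + 2) * (n + 4)) + 2 * ((n + 2) * (κg ^ 2 + σ ^ 2))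

/-- Bound for the squared bias of the two-point estimator. -/
noncomputable def biasBound (n : ℕ) (Lg μ : ℝ) : ℝ :=
  Lg ^ 2 * μ ^ 2 / 4 * (n * (n + 2) * (n + 4))

/-- The mean of the two-point estimator at a fixed point. -/
noncomputable def zoMean [MeasurableSpace Ξ] (P : Measure Ξ) (F : E n → Ξ → ℝ) (μ : ℝ) (x : E n) : E n :=
  ∫ z, zoGrad F μ x z.1 z.2 ∂(P.prod (stdGaussian (E n)))

/-- The Taylor error L_g μ²‖v‖²/2 of the increment μv is divided by μ and multiplied by ‖v‖. -/
theorem norm_zoGrad_sub_le {F : E n → Ξ → ℝ} {Lg : ℝ≥0}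
    (hF : ∀ s, ContDiff ℝ 1 (fun x => F x s))
    (hG : ∀ s, LipschitzWith Lg (fun x => oracleGrad F x s)) {μ : ℝ} (hμ : 0 < μ)
    (x : E n) (s : Ξ) (v : E n) :
    ‖zoGrad F μ x s v - inner ℝ (oracleGrad F x s) v • v‖ ≤ Lg * μ / 2 * ‖v‖ ^ 3 := by
  have h := gradient_taylor ((hF s).differentiable (by norm_num)) (hG s) x (x + μ • v)
  rw [add_sub_cancel_left, norm_smul, inner_smul_right, Real.norm_of_nonneg hμ.le] at h
  rw [zoGrad, ← sub_smul, norm_smul, Real.norm_eq_abs]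
  have e : (F (x + μ • v) s - F x s) / μ - inner ℝ (oracleGrad F x s) v =
      (F (x + μ • v) s - F x s - μ * inner ℝ (oracleGrad F x s) v) / μ := by field_simp
  rw [e, abs_div, abs_of_pos hμ, div_mul_eq_mul_div, div_le_iff₀ hμ]
  calc _ ≤ Lg / 2 * (μ * ‖v‖) ^ 2 * ‖v‖ := by gcongr; exact h
    _ = _ := by ring

section TwoPoint

variable [MeasurableSpace Ξ] {P : Measure Ξ} {f : E n → ℝ}
  {F : E n → Ξ → ℝ} {Lg : ℝ≥0}

theorem AS5.measurable_uncurry (h5 : AS5 P f F Lg) : Measurable fun p : E n × Ξ => F p.1 p.2 :=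
  measurable_uncurry_of_continuous_of_measurable (u := F)
    (fun s => (h5.contDiff s).continuous) h5.measurable

theorem AS5.measurable_zoGrad (h5 : AS5 P f F Lg) (μ : ℝ) :
    Measurable fun p : E n × Ξ × E n => zoGrad F μ p.1 p.2.1 p.2.2 := by
  have h := h5.measurable_uncurry
  have h1 : Measurable fun p : E n × Ξ × E n => F (p.1 + μ • p.2.2) p.2.1 :=
    h.comp (f := fun p : E n × Ξ × E n => (p.1 + μ • p.2.2, p.2.1)) (by fun_prop)
  have h2 : Measurable fun p : E n × Ξ × E n => F p.1 p.2.1 :=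
    h.comp (f := fun p : E n × Ξ × E n => (p.1, p.2.1)) (by fun_prop)
  exact ((h1.sub h2).div_const μ).smul measurable_snd.snd

theorem norm_zoGrad_sub_sq_le (h5 : AS5 P f F Lg) {μ : ℝ} (hμ : 0 < μ) (x : E n) (z : Ξ × E n) :
    ‖zoGrad F μ x z.1 z.2 - inner ℝ (oracleGrad F x z.1) z.2 • z.2‖ ^ 2 ≤
      Lg ^ 2 * μ ^ 2 / 4 * ‖z.2‖ ^ 6 := by
  calc _ ≤ (Lg * μ / 2 * ‖z.2‖ ^ 3) ^ 2 := by
        gcongr; exact norm_zoGrad_sub_le h5.contDiff h5.lipschitz_grad hμ x z.1 z.2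
    _ = _ := by ring

theorem AS4At.aestronglyMeasurable_inner_smul {σ : ℝ} {x : E n} (h4 : AS4At P f F σ x) :
    AEStronglyMeasurable (fun z : Ξ × E n => inner ℝ (oracleGrad F x z.1) z.2 • z.2)
      (P.prod (stdGaussian (E n))) := by
  have h1 : AEStronglyMeasurable (fun z : Ξ × E n => oracleGrad F x z.1)
      (P.prod (stdGaussian (E n))) := h4.integrable.1.comp_fst
  have h2 : AEStronglyMeasurable (fun z : Ξ × E n => z.2) (P.prod (stdGaussian (E n))) :=
    measurable_snd.aestronglyMeasurable
  exact (h1.inner (𝕜 := ℝ) h2).smul h2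

variable [IsProbabilityMeasure P]

/-- Needed on the whole space, although the moment assumptions hold only almost surely along the
iterates. -/
theorem AS5.measurable_zoMean (h5 : AS5 P f F Lg) (μ : ℝ) : Measurable (zoMean P F μ) :=
  ((h5.measurable_zoGrad μ).stronglyMeasurable.integral_prod_right
    (ν := P.prod (stdGaussian (E n)))).measurable

theorem AS4At.memLp {σ : ℝ} {x : E n} (h4 : AS4At P f F σ x) :
    MemLp (fun s => oracleGrad F x s) 2 P := by
  have h : MemLp (fun s => oracleGrad F x s - gradient f x) 2 P :=
    (memLp_two_iff_integrable_sq_norm (h4.integrable.1.sub aestronglyMeasurable_const)).2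
      h4.integrable_sq
  exact MemLp.ae_eq (.of_forall fun s => by simp) (h.add (memLp_const (gradient f x)))

theorem AS4At.integral_norm_sq_le {σ κg : ℝ} {x : E n} (h4 : AS4At P f F σ x)
    (hκ : ‖gradient f x‖ ≤ κg) : ∫ s, ‖oracleGrad F x s‖ ^ 2 ∂P ≤ κg ^ 2 + σ ^ 2 := by
  have h := integral_norm_sub_integral_sq h4.memLp
  have h2 := h4.variance_le
  rw [h4.unbiased] at h
  have : ‖gradient f x‖ ^ 2 ≤ κg ^ 2 := by gcongr
  linarith

theorem norm_inner_smul_sq (a v : E n) : ‖inner ℝ a v • v‖ ^ 2 = (inner ℝ a v) ^ 2 * ‖v‖ ^ 2 := by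
  rw [norm_smul, mul_pow, Real.norm_eq_abs, sq_abs]

section DirectionalPart

variable {σ : ℝ} {x : E n}

theorem AS4At.memLp_inner_smul (h4 : AS4At P f F σ x) :
    MemLp (fun z : Ξ × E n => inner ℝ (oracleGrad F x z.1) z.2 • z.2) 2
      (P.prod (stdGaussian (E n))) := by
  have hm := h4.aestronglyMeasurable_inner_smul
  rw [memLp_two_iff_integrable_sq_norm hm, integrable_prod_iff (hm.norm.fun_pow 2)]
  simp only [norm_inner_smul_sq]
  refine ⟨.of_forall fun s => integrable_inner_pow_mul _ 2 2, ?_⟩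
  have e : ∀ s, ∫ v, ‖(inner ℝ (oracleGrad F x s) v) ^ 2 * ‖v‖ ^ 2‖ ∂(stdGaussian (E n)) =
      (n + 2) * ‖oracleGrad F x s‖ ^ 2 := fun s => by
    rw [← integral_inner_sq_mul_norm_sq]
    exact integral_congr_ae (.of_forall fun v => Real.norm_of_nonneg (by positivity))
  simp_rw [e]
  exact h4.memLp.integrable_norm_pow'.const_mul _

theorem AS4At.integral_norm_inner_smul_sq (h4 : AS4At P f F σ x) :
    ∫ z, ‖inner ℝ (oracleGrad F x z.1) z.2 • z.2‖ ^ 2 ∂(P.prod (stdGaussian (E n))) =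
      (n + 2) * ∫ s, ‖oracleGrad F x s‖ ^ 2 ∂P := by
  rw [integral_prod _ h4.memLp_inner_smul.integrable_norm_pow']
  simp only [norm_inner_smul_sq, integral_inner_sq_mul_norm_sq]
  rw [integral_const_mul]

theorem AS4At.integral_inner_smul (h4 : AS4At P f F σ x) :
    ∫ z, inner ℝ (oracleGrad F x z.1) z.2 • z.2 ∂(P.prod (stdGaussian (E n))) = gradient f x := by
  rw [integral_prod _ (h4.memLp_inner_smul.integrable (by norm_num))]
  simp only [ZOComposite.integral_inner_smul]
  exact h4.unbiased

end DirectionalPart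

section Estimator

variable {σ κg μ : ℝ} {x : E n}

theorem integrable_norm_pow_snd (C : ℝ) (k : ℕ) : Integrable (fun z : Ξ × E n => C * ‖z.2‖ ^ k)
    (P.prod (stdGaussian (E n))) :=
  ((integrable_norm_pow_stdGaussian k).comp_snd P).const_mul C

theorem integral_norm_pow_six_snd (C : ℝ) :
    ∫ z : Ξ × E n, C * ‖z.2‖ ^ 6 ∂(P.prod (stdGaussian (E n))) = C * (n * (n + 2) * (n + 4)) := by
  rw [integral_const_mul, integral_fun_snd (fun v : E n => ‖v‖ ^ 6), integral_norm_pow_six]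
  simp

theorem AS4At.memLp_remainder (h4 : AS4At P f F σ x) (h5 : AS5 P f F Lg) (hμ : 0 < μ) :
    MemLp (fun z : Ξ × E n => zoGrad F μ x z.1 z.2 - inner ℝ (oracleGrad F x z.1) z.2 • z.2) 2
      (P.prod (stdGaussian (E n))) := by
  have hm : AEStronglyMeasurable (fun z : Ξ × E n => zoGrad F μ x z.1 z.2 -
      inner ℝ (oracleGrad F x z.1) z.2 • z.2) (P.prod (stdGaussian (E n))) :=
    ((h5.measurable_zoGrad μ).comp measurable_prodMk_left).aestronglyMeasurable.sub
      h4.aestronglyMeasurable_inner_smul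
  rw [memLp_two_iff_integrable_sq_norm hm]
  refine (integrable_norm_pow_snd (Lg ^ 2 * μ ^ 2 / 4) 6).mono' (hm.norm.pow 2)
    (.of_forall fun z => ?_)
  rw [Real.norm_of_nonneg (sq_nonneg _)]
  exact norm_zoGrad_sub_sq_le h5 hμ x z

theorem AS4At.memLp_zoGrad (h4 : AS4At P f F σ x) (h5 : AS5 P f F Lg) (hμ : 0 < μ) :
    MemLp (fun z : Ξ × E n => zoGrad F μ x z.1 z.2) 2 (P.prod (stdGaussian (E n))) := by
  exact MemLp.ae_eq (.of_forall fun s => by simp) ((h4.memLp_remainder h5 hμ).add h4.memLp_inner_smul)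

/-- Split off the directional part ⟨∇F, v⟩v and use ‖a + b‖² ≤ 2‖a‖² + 2‖b‖²; the two moments are
the exact Gaussian ones. -/
theorem AS4At.integral_norm_zoGrad_sq_le (h4 : AS4At P f F σ x) (h5 : AS5 P f F Lg) (hμ : 0 < μ)
    (hκ : ‖gradient f x‖ ≤ κg) :
    ∫ z, ‖zoGrad F μ x z.1 z.2‖ ^ 2 ∂(P.prod (stdGaussian (E n))) ≤ momentBound n Lg μ σ κg := by
  have i1 := integrable_norm_pow_snd (n := n) (P := P) (Lg ^ 2 * μ ^ 2 / 2) 6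
  have i2 := h4.memLp_inner_smul.integrable_norm_pow'.const_mul 2
  have hle : ∀ z : Ξ × E n, ‖zoGrad F μ x z.1 z.2‖ ^ 2 ≤ Lg ^ 2 * μ ^ 2 / 2 * ‖z.2‖ ^ 6 +
      2 * ‖inner ℝ (oracleGrad F x z.1) z.2 • z.2‖ ^ 2 := fun z => by
    have h1 := norm_zoGrad_sub_sq_le h5 hμ x z
    have h2 := norm_add_le (zoGrad F μ x z.1 z.2 - inner ℝ (oracleGrad F x z.1) z.2 • z.2)
      (inner ℝ (oracleGrad F x z.1) z.2 • z.2)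
    rw [sub_add_cancel] at h2
    have h3 := pow_le_pow_left₀ (norm_nonneg _) h2 2
    have h4 := add_sq_le (a := ‖zoGrad F μ x z.1 z.2 - inner ℝ (oracleGrad F x z.1) z.2 • z.2‖)
      (b := ‖inner ℝ (oracleGrad F x z.1) z.2 • z.2‖)
    linarith
  have h := integral_mono (h4.memLp_zoGrad h5 hμ).integrable_norm_pow' (i1.add i2) hle
  refine h.trans ?_
  simp only [Pi.add_apply]
  erw [integral_add i1 i2]
  have h6 := h4.integral_norm_sq_le hκ
  rw [integral_norm_pow_six_snd, integral_const_mul]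
  erw [h4.integral_norm_inner_smul_sq]
  unfold momentBound
  gcongr

/-- The directional part has mean ∇f exactly, so the bias is the mean of the Taylor remainder,
bounded by its second moment. -/
theorem AS4At.norm_zoMean_sub_sq_le (h4 : AS4At P f F σ x) (h5 : AS5 P f F Lg) (hμ : 0 < μ) :
    ‖zoMean P F μ x - gradient f x‖ ^ 2 ≤ biasBound n Lg μ := by
  have hr := h4.memLp_remainder h5 hμ
  rw [zoMean, ← h4.integral_inner_smul, ← integral_sub
    ((h4.memLp_zoGrad h5 hμ).integrable (by norm_num))
    (h4.memLp_inner_smul.integrable (by norm_num))]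
  refine (norm_integral_sq_le hr).trans ?_
  refine (integral_mono hr.integrable_norm_pow' (integrable_norm_pow_snd _ 6)
    (norm_zoGrad_sub_sq_le h5 hμ x)).trans ?_
  rw [integral_norm_pow_six_snd, biasBound]

end Estimator

end TwoPoint

/-! ### Independence, centred sums and independent stopping. -/

section Independence

variable {Ω α β ι : Type*} [mΩ : MeasurableSpace Ω] {Pr : Measure Ω}
  [MeasurableSpace α] [MeasurableSpace β]

theorem indepFun_of_measurable_iSup {Z : ι → Ω → β} (hZm : ∀ i, Measurable (Z i))
    (hZ : iIndepFun Z Pr) {S : Set ι} {i₀ : ι} (hi : i₀ ∉ S) {W : Ω → α}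
    (hW : Measurable[⨆ i ∈ S, MeasurableSpace.comap (Z i) inferInstance] W) :
    IndepFun W (Z i₀) Pr := by
  have h := indep_iSup_of_disjoint (fun i => (hZm i).comap_le) hZ
    (Set.disjoint_singleton_right.2 hi)
  rw [IndepFun_iff_Indep]
  refine indep_of_indep_of_le_left (indep_of_indep_of_le_right h ?_) hW.comap_le
  simp

theorem integrable_inner_of_memLp {V : Type*} [NormedAddCommGroup V]
    [InnerProductSpace ℝ V] {X Y : Ω → V} (hX : MemLp X 2 Pr) (hY : MemLp Y 2 Pr) :
    Integrable (fun ω => (inner ℝ (X ω) (Y ω) : ℝ)) Pr := by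
  refine ((hX.integrable_norm_pow two_ne_zero).add (hY.integrable_norm_pow two_ne_zero)).mono'
    (hX.1.inner (𝕜 := ℝ) hY.1) (.of_forall fun ω => ?_)
  refine (norm_inner_le_norm _ _).trans ?_
  change _ ≤ ‖X ω‖ ^ 2 + ‖Y ω‖ ^ 2
  nlinarith [sq_nonneg (‖X ω‖ - ‖Y ω‖), sq_nonneg (‖X ω‖ + ‖Y ω‖)]

/-- Fubini in place of conditional expectation: (W, Z) has a product law, so a bound valid for
almost every frozen value of W integrates. The nonnegative integral is used because integrability is
part of the claim. -/
theorem memLp_comp_of_indepFun [IsProbabilityMeasure Pr] {Q : Measure β} {V : Type*}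
    [NormedAddCommGroup V] [MeasurableSpace V] [BorelSpace V] [SecondCountableTopology V] {W : Ω → α} {Z : Ω → β} (hW : Measurable W)
    (hZ : Measurable Z) (hWZ : IndepFun W Z Pr) (hQ : Pr.map Z = Q) {φ : α × β → V}
    (hφ : Measurable φ) {C : ℝ}
    (h0 : ∀ᵐ ω ∂Pr, MemLp (fun z => φ (W ω, z)) 2 Q ∧ ∫ z, ‖φ (W ω, z)‖ ^ 2 ∂Q ≤ C) :
    MemLp (fun ω => φ (W ω, Z ω)) 2 Pr ∧ ∫ ω, ‖φ (W ω, Z ω)‖ ^ 2 ∂Pr ≤ C := by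
  have : IsProbabilityMeasure Q := hQ ▸ Measure.isProbabilityMeasure_map hZ.aemeasurable
  have : IsProbabilityMeasure (Pr.map W) := Measure.isProbabilityMeasure_map hW.aemeasurable
  have hmap : Pr.map (fun ω => (W ω, Z ω)) = (Pr.map W).prod Q := by
    rw [← hQ]; exact (indepFun_iff_map_prod_eq_prod_map_map hW.aemeasurable hZ.aemeasurable).1 hWZ
  have hg : Measurable fun p : α × β => ENNReal.ofReal (‖φ p‖ ^ 2) := by fun_prop
  have hC : 0 ≤ C := by
    obtain ⟨ω, hω⟩ := h0.exists
    exact (integral_nonneg fun _ => sq_nonneg _).trans hω.2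
  have hle : ∫⁻ ω, ENNReal.ofReal (‖φ (W ω, Z ω)‖ ^ 2) ∂Pr ≤ ENNReal.ofReal C := by
    rw [← lintegral_map hg (hW.prodMk hZ), hmap, lintegral_prod _ hg.aemeasurable,
      lintegral_map hg.lintegral_prod_right' hW]
    refine (lintegral_mono_ae (g := fun _ => ENNReal.ofReal C) ?_).trans (by simp)
    filter_upwards [h0] with ω hω
    rw [← ofReal_integral_eq_lintegral_ofReal hω.1.integrable_norm_pow'
      (.of_forall fun _ => sq_nonneg _)]
    exact ENNReal.ofReal_le_ofReal hω.2
  have hm : Measurable fun ω => φ (W ω, Z ω) := hφ.comp (hW.prodMk hZ)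
  have hint : Integrable (fun ω => ‖φ (W ω, Z ω)‖ ^ 2) Pr :=
    (lintegral_ofReal_ne_top_iff_integrable (hm.norm.pow_const 2).aestronglyMeasurable (.of_forall fun _ => sq_nonneg _)).1
      (hle.trans_lt ENNReal.ofReal_lt_top).ne
  refine ⟨(memLp_two_iff_integrable_sq_norm hm.aestronglyMeasurable).2 hint, ?_⟩
  rw [← ofReal_integral_eq_lintegral_ofReal hint (.of_forall fun _ => sq_nonneg _)] at hle
  exact (ENNReal.ofReal_le_ofReal_iff hC).1 hle

variable [IsProbabilityMeasure Pr] {Q : Measure β}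
  {V : Type*} [NormedAddCommGroup V] [InnerProductSpace ℝ V] [CompleteSpace V]
  [MeasurableSpace V] [BorelSpace V] [SecondCountableTopology V]

/-- With W frozen, ψ(W) is constant and the integral over Z vanishes. -/
theorem integral_inner_eq_zero_of_indepFun {W : Ω → α} {Z : Ω → β} (hW : Measurable W)
    (hZ : Measurable Z) (hWZ : IndepFun W Z Pr) (hQ : Pr.map Z = Q) {φ : α × β → V} {ψ : α → V}
    (hφ : Measurable φ) (hψ : Measurable ψ)
    (h0 : ∀ᵐ ω ∂Pr, Integrable (fun z => φ (W ω, z)) Q ∧ ∫ z, φ (W ω, z) ∂Q = 0)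
    (hi : Integrable (fun ω => inner ℝ (ψ (W ω)) (φ (W ω, Z ω))) Pr) :
    ∫ ω, inner ℝ (ψ (W ω)) (φ (W ω, Z ω)) ∂Pr = 0 := by
  have : IsProbabilityMeasure Q := hQ ▸ Measure.isProbabilityMeasure_map hZ.aemeasurable
  have : IsProbabilityMeasure (Pr.map W) := Measure.isProbabilityMeasure_map hW.aemeasurable
  have hmap : Pr.map (fun ω => (W ω, Z ω)) = (Pr.map W).prod Q := by
    rw [← hQ]; exact (indepFun_iff_map_prod_eq_prod_map_map hW.aemeasurable hZ.aemeasurable).1 hWZ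
  have hg : Measurable fun p : α × β => (inner ℝ (ψ p.1) (φ p) : ℝ) :=
    (hψ.comp measurable_fst).inner hφ
  have hi' : Integrable (fun p : α × β => (inner ℝ (ψ p.1) (φ p) : ℝ)) ((Pr.map W).prod Q) := by
    rw [← hmap]
    exact (integrable_map_measure hg.aestronglyMeasurable (hW.prodMk hZ).aemeasurable).2 hi
  have h1 := integral_map (hW.prodMk hZ).aemeasurable (μ := Pr)
    (hg.aestronglyMeasurable (μ := Pr.map fun ω => (W ω, Z ω)))
  simp only at h1
  rw [← h1, hmap, integral_prod _ hi', integral_map hW.aemeasurable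
    hi'.integral_prod_left.aestronglyMeasurable]
  refine integral_eq_zero_of_ae ?_
  filter_upwards [h0] with ω hω
  rw [integral_inner hω.1, hω.2, inner_zero_right]; rfl

/-- Sums of conditionally centred samples: orthogonality and the variance bound. -/
theorem sum_conditionally_centred {Z : ι → Ω → β} (hZm : ∀ i, Measurable (Z i))
    (hZ : iIndepFun Z Pr) (hQ : ∀ i, Pr.map (Z i) = Q) {S : Set ι} {X : Ω → α}
    (hX : Measurable[⨆ i ∈ S, MeasurableSpace.comap (Z i) inferInstance] X)
    {Y : α × β → V} (hY : Measurable Y) {C : ℝ}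
    (h0 : ∀ᵐ ω ∂Pr, MemLp (fun z => Y (X ω, z)) 2 Q ∧ ∫ z, Y (X ω, z) ∂Q = 0 ∧
      ∫ z, ‖Y (X ω, z)‖ ^ 2 ∂Q ≤ C)
    {e : ℕ → ι} (he : Function.Injective e) (heS : ∀ i, e i ∉ S) (t : Finset ℕ) :
    MemLp (fun ω => ∑ i ∈ t, Y (X ω, Z (e i) ω)) 2 Pr ∧
    ∫ ω, ‖∑ i ∈ t, Y (X ω, Z (e i) ω)‖ ^ 2 ∂Pr ≤ t.card * C ∧
    ∀ ψ : α → V, Measurable ψ → MemLp (fun ω => ψ (X ω)) 2 Pr →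
      ∫ ω, inner ℝ (ψ (X ω)) (∑ i ∈ t, Y (X ω, Z (e i) ω)) ∂Pr = 0 := by
  have : IsProbabilityMeasure Q := by
    rw [← hQ (e 0)]; exact Measure.isProbabilityMeasure_map (hZm _).aemeasurable
  have hle : (⨆ i ∈ S, MeasurableSpace.comap (Z i) inferInstance) ≤ mΩ :=
    iSup₂_le fun i _ => (hZm i).comap_le
  have hXm : Measurable X := hX.mono hle le_rfl
  have hind : ∀ i, IndepFun X (Z (e i)) Pr := fun i =>
    indepFun_of_measurable_iSup hZm hZ (heS i) hX
  have hLp := fun i => memLp_comp_of_indepFun hXm (hZm (e i)) (hind i) (hQ _) hY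
    (h0.mono fun ω hω => ⟨hω.1, hω.2.2⟩)
  -- Freeze X together with the sample `e j`: this pair is still independent of the sample `e i`,
  -- whose term is centred given X.
  have horth : ∀ i j, i ≠ j → ∫ ω, inner ℝ (Y (X ω, Z (e j) ω)) (Y (X ω, Z (e i) ω)) ∂Pr = 0 := by
    intro i j hij
    have hW : Measurable[⨆ k ∈ insert (e j) S, MeasurableSpace.comap (Z k) inferInstance]
        (fun ω => (X ω, Z (e j) ω)) := by
      refine Measurable.prodMk (hX.mono (biSup_mono fun k hk => Set.mem_insert_of_mem _ hk) le_rfl) ?_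
      exact (comap_measurable (Z (e j))).mono
        (le_iSup₂_of_le (e j) (Set.mem_insert _ _) le_rfl) le_rfl
    have hn : e i ∉ insert (e j) S := by
      simp only [Set.mem_insert_iff, not_or]
      exact ⟨fun h => hij (he h), heS i⟩
    exact integral_inner_eq_zero_of_indepFun (hXm.prodMk (hZm (e j))) (hZm (e i))
      (indepFun_of_measurable_iSup hZm hZ hn hW) (hQ _)
      (φ := fun p => Y (p.1.1, p.2)) (ψ := Y) (by fun_prop) hY
      (h0.mono fun ω hω => ⟨hω.1.integrable (by norm_num), hω.2.1⟩)
      (integrable_inner_of_memLp (hLp j).1 (hLp i).1)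
  refine ⟨memLp_finsetSum _ fun i _ => (hLp i).1, ?_, fun ψ hψ hψX => ?_⟩
  · have hexp : ∀ ω, ‖∑ i ∈ t, Y (X ω, Z (e i) ω)‖ ^ 2 =
        ∑ j ∈ t, ∑ i ∈ t, inner ℝ (Y (X ω, Z (e j) ω)) (Y (X ω, Z (e i) ω)) := fun ω => by
      rw [← real_inner_self_eq_norm_sq, sum_inner]
      exact Finset.sum_congr rfl fun j _ => inner_sum _ _ _
    simp_rw [hexp]
    rw [integral_finsetSum _ fun j _ => integrable_finsetSum _ fun i _ =>
      integrable_inner_of_memLp (hLp j).1 (hLp i).1]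
    calc _ ≤ ∑ j ∈ t, C := Finset.sum_le_sum fun j hj => by
          rw [integral_finsetSum _ fun i _ => integrable_inner_of_memLp (hLp j).1 (hLp i).1,
            Finset.sum_eq_single_of_mem j hj fun i _ hij => horth i j hij]
          simp_rw [real_inner_self_eq_norm_sq]
          exact (hLp j).2
      _ = _ := by rw [Finset.sum_const, nsmul_eq_mul]
  · simp_rw [inner_sum]
    rw [integral_finsetSum _ fun i _ => integrable_inner_of_memLp hψX (hLp i).1]
    exact Finset.sum_eq_zero fun i _ => integral_inner_eq_zero_of_indepFun hXm (hZm (e i)) (hind i)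
      (hQ _) hY hψ (h0.mono fun ω hω => ⟨hω.1.integrable (by norm_num), hω.2.1⟩)
      (integrable_inner_of_memLp hψX (hLp i).1)

/-- Expectation of a process stopped at an independent random index. -/
theorem integral_stopped_at_indep {R : Ω → ℕ} (hR : Measurable R) {s : Finset ℕ}
    (hRs : ∀ ω, R ω ∈ s) {φ : ℕ → Ω → ℝ} (hφ : ∀ k ∈ s, Integrable (φ k) Pr)
    (hind : ∀ k ∈ s, IndepFun R (φ k) Pr) :
    Integrable (fun ω => φ (R ω) ω) Pr ∧
    ∫ ω, φ (R ω) ω ∂Pr = ∑ k ∈ s, Pr.real {ω | R ω = k} * ∫ ω, φ k ω ∂Pr := by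
  have e : (fun ω => φ (R ω) ω) = fun ω => ∑ k ∈ s, (if R ω = k then 1 else 0) * φ k ω := by
    ext ω
    simp [hRs ω]
  have hm : ∀ k, Measurable fun r : ℕ => if r = k then (1 : ℝ) else 0 := fun k =>
    measurable_of_countable _
  have hi1 : ∀ k, Integrable (fun ω => if R ω = k then (1 : ℝ) else 0) Pr := fun k => by
    refine (integrable_const (1 : ℝ)).mono' ((hm k).comp hR).aestronglyMeasurable
      (.of_forall fun ω => ?_)
    split_ifs <;> simp
  have hind' : ∀ k ∈ s, IndepFun (fun ω => if R ω = k then (1 : ℝ) else 0) (φ k) Pr :=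
    fun k hk => (hind k hk).comp (hm k) measurable_id
  have hi : ∀ k ∈ s, Integrable (fun ω => (if R ω = k then (1 : ℝ) else 0) * φ k ω) Pr :=
    fun k hk => (hind' k hk).integrable_mul (hi1 k) (hφ k hk)
  rw [e]
  refine ⟨integrable_finsetSum _ hi, ?_⟩
  rw [integral_finsetSum _ hi]
  refine Finset.sum_congr rfl fun k hk => ?_
  rw [(hind' k hk).integral_fun_mul_eq_mul_integral (hi1 k).1 (hφ k hk).1]
  congr 1
  rw [show {ω | R ω = k} = R ⁻¹' {k} from rfl,
    ← integral_indicator_one (hR (measurableSet_singleton k))]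
  refine integral_congr_ae (.of_forall fun ω => ?_)
  by_cases h : R ω = k <;> simp [h]

end Independence

/-! ### One step with a noisy gradient. -/

section Step

variable {Ω : Type*} [MeasurableSpace Ω] {Pr : Measure Ω} [IsProbabilityMeasure Pr]
  {f : E n → ℝ} {c : E n → E q} {h : E q → ℝ} {Lg Lh LJ : ℝ≥0} {Φlow : ℝ}

theorem AS1.measurable_gradient (h1 : AS1 f c Lg LJ) : Measurable (gradient f) :=
  h1.lipschitz_grad.continuous.measurable

theorem measurable_proxPoint_comp {Ω : Type*} [MeasurableSpace Ω] (h1 : AS1 f c Lg LJ)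
    (hh : AS2 h Lh) {γ : ℝ} (hγ : 0 < γ)
    {X G : Ω → E n} (hX : Measurable X) (hG : Measurable G) :
    Measurable fun ω => proxPoint c h γ (X ω) (G ω) := by
  have hm := (continuous_proxPoint h1.contDiff_c hh hγ).measurable
  have := hm.comp (hX.prodMk hG)
  simpa only [Function.comp_def] using this

theorem measurable_genGrad_comp {Ω : Type*} [MeasurableSpace Ω] (h1 : AS1 f c Lg LJ)
    (hh : AS2 h Lh) {γ : ℝ} (hγ : 0 < γ)
    {X G : Ω → E n} (hX : Measurable X) (hG : Measurable G) :
    Measurable fun ω => genGrad c h γ (X ω) (G ω) :=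
  (hX.sub (measurable_proxPoint_comp h1 hh hγ hX hG)).const_smul (1 / γ)

theorem continuous_Phi (h1 : AS1 f c Lg LJ) (hh : AS2 h Lh) : Continuous (Phi f c h) := by
  have e1 := h1.contDiff_f.continuous
  have e2 := h1.contDiff_c.continuous
  have e3 := hh.lipschitz.continuous
  unfold Phi
  fun_prop

theorem Phi_proxPoint_step_le (h1 : AS1 f c Lg LJ) (hh : AS2 h Lh)
    (hL : 0 < stepL Lg Lh LJ) (x g : E n) :
    Phi f c h (proxPoint c h (1 / stepL Lg Lh LJ) x g) ≤ Phi f c h x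
      - 1 / stepL Lg Lh LJ / 2 * ‖genGrad c h (1 / stepL Lg Lh LJ) x g‖ ^ 2
      + 1 / stepL Lg Lh LJ *
        inner ℝ (g - gradient f x) (genGrad c h (1 / stepL Lg Lh LJ) x g) := by
  have := Phi_proxPoint_le h1 hh (γ := 1 / stepL Lg Lh LJ) (by positivity) x g
  have e : 1 / stepL Lg Lh LJ - stepL Lg Lh LJ * (1 / stepL Lg Lh LJ) ^ 2 / 2 =
      1 / stepL Lg Lh LJ / 2 := by field_simp; ring
  rwa [e] at this

theorem norm_sq_le_two_mul {V : Type*} [SeminormedAddCommGroup V] (a b : V) :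
    ‖a‖ ^ 2 ≤ 2 * ‖b‖ ^ 2 + 2 * ‖a - b‖ ^ 2 := by
  have h := norm_add_le b (a - b)
  rw [add_sub_cancel] at h
  have h2 := pow_le_pow_left₀ (norm_nonneg _) h 2
  have h3 := add_sq_le (a := ‖b‖) (b := ‖a - b‖)
  linarith

/-- One step of the method with a noisy gradient `G`, whose conditional mean is `M ∘ X`. -/
theorem step_estimate (h1 : AS1 f c Lg LJ) (hh : AS2 h Lh) (h3 : AS3 f c h Φlow)
    (hL : 0 < stepL Lg Lh LJ) {γ : ℝ} (hγ : γ = 1 / stepL Lg Lh LJ)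
    {X G : Ω → E n} {M : E n → E n} (hX : Measurable X) (hG : Measurable G) (hM : Measurable M)
    (hΦ : Integrable (fun ω => Phi f c h (X ω)) Pr) {V B : ℝ}
    (hn : MemLp (fun ω => G ω - M (X ω)) 2 Pr) (hV : ∫ ω, ‖G ω - M (X ω)‖ ^ 2 ∂Pr ≤ V)
    (horth : ∀ ψ : E n → E n, Measurable ψ → MemLp (fun ω => ψ (X ω)) 2 Pr →
      ∫ ω, inner ℝ (ψ (X ω)) (G ω - M (X ω)) ∂Pr = 0)
    (hB : ∀ᵐ ω ∂Pr, ‖M (X ω) - gradient f (X ω)‖ ^ 2 ≤ B) :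
    Integrable (fun ω => Phi f c h (proxPoint c h γ (X ω) (G ω))) Pr ∧
    Integrable (fun ω => ‖genGrad c h γ (X ω) (G ω)‖ ^ 2) Pr ∧
    Integrable (fun ω => ‖genGrad c h γ (X ω) (gradient f (X ω))‖ ^ 2) Pr ∧
    ∫ ω, Phi f c h (proxPoint c h γ (X ω) (G ω)) ∂Pr +
      3 * γ / 8 * ∫ ω, ‖genGrad c h γ (X ω) (G ω)‖ ^ 2 ∂Pr ≤
      ∫ ω, Phi f c h (X ω) ∂Pr + γ * (V + 2 * B) ∧
    ∫ ω, ‖genGrad c h γ (X ω) (gradient f (X ω))‖ ^ 2 ∂Pr ≤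
      2 * ∫ ω, ‖genGrad c h γ (X ω) (G ω)‖ ^ 2 ∂Pr + 4 * V + 4 * B := by
  have hγ0 : 0 < γ := by rw [hγ]; positivity
  have mg := h1.measurable_gradient
  have mt := measurable_genGrad_comp h1 hh hγ0 hX (mg.comp hX)
  have mp := measurable_genGrad_comp h1 hh hγ0 hX (hM.comp hX)
  have mr := measurable_genGrad_comp h1 hh hγ0 hX hG
  have mΦ : Measurable fun ω => Phi f c h (proxPoint c h γ (X ω) (G ω)) :=
    (continuous_Phi h1 hh).measurable.comp (measurable_proxPoint_comp h1 hh hγ0 hX hG)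
  simp only [Function.comp_apply] at mt mp
  have hdesc : ∀ x g, Phi f c h (proxPoint c h γ x g) ≤ Phi f c h x
      - γ / 2 * ‖genGrad c h γ x g‖ ^ 2 + γ * inner ℝ (g - gradient f x) (genGrad c h γ x g) := by
    rw [hγ]; exact Phi_proxPoint_step_le h1 hh hL
  -- A noiseless step lowers Φ by at least (γ/2)‖P_γ(x,∇f)‖², and Φ ≥ Φlow, so Φ(X) − Φlow
  -- dominates.
  have it : Integrable (fun ω => ‖genGrad c h γ (X ω) (gradient f (X ω))‖ ^ 2) Pr := by
    refine (((hΦ.sub (integrable_const Φlow)).const_mul (2 / γ))).mono'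
      (mt.norm.pow_const 2).aestronglyMeasurable (.of_forall fun ω => ?_)
    have a1 := hdesc (X ω) (gradient f (X ω))
    have a2 := h3 (proxPoint c h γ (X ω) (gradient f (X ω)))
    rw [sub_self, inner_zero_left, mul_zero, add_zero] at a1
    rw [Real.norm_of_nonneg (sq_nonneg _), Pi.sub_apply, div_mul_eq_mul_div, le_div_iff₀ hγ0]
    linarith
  have ip : MemLp (fun ω => genGrad c h γ (X ω) (M (X ω))) 2 Pr := by
    rw [memLp_two_iff_integrable_sq_norm mp.aestronglyMeasurable]
    refine ((it.const_mul 2).add (integrable_const (2 * B))).mono'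
      (mp.norm.pow_const 2).aestronglyMeasurable (hB.mono fun ω hω => ?_)
    rw [Real.norm_of_nonneg (sq_nonneg _), Pi.add_apply]
    have a1 := norm_sq_le_two_mul (genGrad c h γ (X ω) (M (X ω)))
      (genGrad c h γ (X ω) (gradient f (X ω)))
    have a2 := pow_le_pow_left₀ (norm_nonneg _)
      (norm_genGrad_sub_le c hh hγ0 (X ω) (gradient f (X ω)) (M (X ω))) 2
    linarith
  have iin := integrable_inner_of_memLp ip hn
  have insq := hn.integrable_norm_pow two_ne_zero
  set U : Ω → ℝ := fun ω => Phi f c h (X ω) +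
    γ * (inner ℝ (genGrad c h γ (X ω) (M (X ω))) (G ω - M (X ω)) + ‖G ω - M (X ω)‖ ^ 2 + 2 * B)
    with hU
  have iU0 : Integrable (fun ω => γ * ((inner ℝ (genGrad c h γ (X ω) (M (X ω))) (G ω - M (X ω)) : ℝ)
      + ‖G ω - M (X ω)‖ ^ 2 + 2 * B)) Pr :=
    ((iin.add insq).add (integrable_const (2 * B))).const_mul γ
  have iU : Integrable U Pr := hΦ.add iU0
  have key : ∀ᵐ ω ∂Pr, Phi f c h (proxPoint c h γ (X ω) (G ω)) +
      3 * γ / 8 * ‖genGrad c h γ (X ω) (G ω)‖ ^ 2 ≤ U ω := hB.mono fun ω hω => by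
    have a1 := hdesc (X ω) (G ω)
    set r := genGrad c h γ (X ω) (G ω)
    set p := genGrad c h γ (X ω) (M (X ω))
    set ν := G ω - M (X ω)
    set β := M (X ω) - gradient f (X ω)
    -- Replacing r by p isolates ⟨p, ν⟩, whose mean is zero because p is a function of X alone.
    have e : inner ℝ (G ω - gradient f (X ω)) r = inner ℝ p ν + inner ℝ ν (r - p) + inner ℝ β r := by
      rw [show G ω - gradient f (X ω) = ν + β from by simp only [ν, β]; abel, inner_add_left,
        inner_sub_right ν r p, real_inner_comm ν p]
      ring
    have a2 : inner ℝ ν (r - p) ≤ ‖ν‖ ^ 2 := by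
      refine (real_inner_le_norm _ _).trans ?_
      rw [pow_two]
      gcongr
      exact norm_genGrad_sub_le c hh hγ0 (X ω) (M (X ω)) (G ω)
    -- Young's inequality with weight 1/8: of the decrease γ/2, the part 3γ/8 survives.
    have a3 : inner ℝ β r ≤ ‖r‖ ^ 2 / 8 + 2 * B := by
      refine (real_inner_le_norm _ _).trans ?_
      nlinarith [sq_nonneg (‖r‖ - 4 * ‖β‖)]
    rw [e] at a1
    have a4 : γ * (inner ℝ p ν + inner ℝ ν (r - p) + inner ℝ β r) ≤
        γ * (inner ℝ p ν + ‖ν‖ ^ 2 + (‖r‖ ^ 2 / 8 + 2 * B)) := by gcongr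
    simp only [hU]
    linarith
  -- The new Φ lies between Φlow and the integrable U, since the term in ‖r‖² is nonnegative.
  have iΦ : Integrable (fun ω => Phi f c h (proxPoint c h γ (X ω) (G ω))) Pr := by
    have : Integrable (fun ω => Phi f c h (proxPoint c h γ (X ω) (G ω)) - Φlow) Pr := by
      refine (iU.sub (integrable_const Φlow)).mono' (mΦ.sub_const _).aestronglyMeasurable
        (key.mono fun ω hω => ?_)
      have := h3 (proxPoint c h γ (X ω) (G ω))
      rw [Real.norm_of_nonneg (by linarith), Pi.sub_apply]
      have : 0 ≤ 3 * γ / 8 * ‖genGrad c h γ (X ω) (G ω)‖ ^ 2 := by positivity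
      linarith
    exact (this.add (integrable_const Φlow)).congr (.of_forall fun ω => by simp)
  have ir : Integrable (fun ω => ‖genGrad c h γ (X ω) (G ω)‖ ^ 2) Pr := by
    refine ((iU.sub (integrable_const Φlow)).const_mul (8 / (3 * γ))).mono'
      (mr.norm.pow_const 2).aestronglyMeasurable (key.mono fun ω hω => ?_)
    have := h3 (proxPoint c h γ (X ω) (G ω))
    rw [Real.norm_of_nonneg (sq_nonneg _), Pi.sub_apply, div_mul_eq_mul_div,
      le_div_iff₀ (by positivity)]
    linarith
  refine ⟨iΦ, ir, it, ?_, ?_⟩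
  · have a := integral_mono_ae (iΦ.add (ir.const_mul (3 * γ / 8))) iU key
    simp only [Pi.add_apply] at a
    have iS : Integrable (fun ω => (inner ℝ (genGrad c h γ (X ω) (M (X ω))) (G ω - M (X ω)) : ℝ) +
        ‖G ω - M (X ω)‖ ^ 2) Pr := iin.add insq
    rw [integral_add iΦ (ir.const_mul _), integral_const_mul, hU, integral_add hΦ iU0,
      integral_const_mul, integral_add iS (integrable_const _),
      integral_add iin insq, horth (fun x => genGrad c h γ x (M x))
      (measurable_genGrad_comp h1 hh hγ0 measurable_id hM) ip] at a
    simp only [integral_const, probReal_univ, one_smul, zero_add] at a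
    have : γ * (∫ ω, ‖G ω - M (X ω)‖ ^ 2 ∂Pr + 2 * B) ≤ γ * (V + 2 * B) := by gcongr
    linarith
  · have hle : ∀ᵐ ω ∂Pr, ‖genGrad c h γ (X ω) (gradient f (X ω))‖ ^ 2 ≤
        2 * ‖genGrad c h γ (X ω) (G ω)‖ ^ 2 + 4 * ‖G ω - M (X ω)‖ ^ 2 + 4 * B :=
      hB.mono fun ω hω => by
        have a1 := norm_sq_le_two_mul (genGrad c h γ (X ω) (gradient f (X ω)))
          (genGrad c h γ (X ω) (G ω))
        have a2 := pow_le_pow_left₀ (norm_nonneg _)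
          (norm_genGrad_sub_le c hh hγ0 (X ω) (G ω) (gradient f (X ω))) 2
        have a3 := norm_sq_le_two_mul (gradient f (X ω) - G ω) (M (X ω) - G ω)
        rw [sub_sub_sub_cancel_right, norm_sub_rev (gradient f (X ω)) (M (X ω)),
          norm_sub_rev (M (X ω)) (G ω)] at a3
        linarith
    have a := integral_mono_ae it (((ir.const_mul 2).add (insq.const_mul 4)).add
      (integrable_const (4 * B))) hle
    simp only [Pi.add_apply] at a
    have iS : Integrable (fun ω => 2 * ‖genGrad c h γ (X ω) (G ω)‖ ^ 2 +
        4 * ‖G ω - M (X ω)‖ ^ 2) Pr := (ir.const_mul 2).add (insq.const_mul 4)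
    rw [integral_add iS (integrable_const _), integral_add (ir.const_mul 2) (insq.const_mul 4), integral_const_mul,
      integral_const_mul] at a
    simp only [integral_const, probReal_univ, one_smul] at a
    linarith

end Step

/-! ### Noise of the batch average. -/

section Batch

variable {Ω ι : Type*} [mΩ : MeasurableSpace Ω] {Pr : Measure Ω} [IsProbabilityMeasure Pr]
  [MeasurableSpace Ξ] {P : Measure Ξ} [IsProbabilityMeasure P] {f : E n → ℝ}
  {F : E n → Ξ → ℝ} {Lg : ℝ≥0}

/-- Conditional mean and variance of the batch average of two-point estimators. -/
theorem batchGrad_noise (h5 : AS5 P f F Lg) {μ σ κg : ℝ} (hμ : 0 < μ)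
    {Z : ι → Ω → Ξ × E n} (hZm : ∀ i, Measurable (Z i)) (hZ : iIndepFun Z Pr)
    (hQ : ∀ i, Pr.map (Z i) = P.prod (stdGaussian (E n))) {S : Set ι} {X : Ω → E n}
    (hX : Measurable[⨆ i ∈ S, MeasurableSpace.comap (Z i) inferInstance] X)
    (h4 : ∀ᵐ ω ∂Pr, AS4At P f F σ (X ω)) (hκ : ∀ᵐ ω ∂Pr, ‖gradient f (X ω)‖ ≤ κg)
    {e : ℕ → ι} (he : Function.Injective e) (heS : ∀ i, e i ∉ S) {m : ℕ} (hm : 0 < m)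
    {G : Ω → E n} (hG : G = fun ω => batchGrad F μ m (X ω) (fun i => (Z (e i) ω).1)
      (fun i => (Z (e i) ω).2)) :
    MemLp (fun ω => G ω - zoMean P F μ (X ω)) 2 Pr ∧
    ∫ ω, ‖G ω - zoMean P F μ (X ω)‖ ^ 2 ∂Pr ≤ momentBound n Lg μ σ κg / m ∧
    ∀ ψ : E n → E n, Measurable ψ → MemLp (fun ω => ψ (X ω)) 2 Pr →
      ∫ ω, inner ℝ (ψ (X ω)) (G ω - zoMean P F μ (X ω)) ∂Pr = 0 := by
  let Y : E n × (Ξ × E n) → E n := fun p => zoGrad F μ p.1 p.2.1 p.2.2 - zoMean P F μ p.1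
  have hY : Measurable Y := (h5.measurable_zoGrad μ).sub ((h5.measurable_zoMean μ).comp measurable_fst)
  have h0 : ∀ᵐ ω ∂Pr, MemLp (fun z => Y (X ω, z)) 2 (P.prod (stdGaussian (E n))) ∧
      ∫ z, Y (X ω, z) ∂(P.prod (stdGaussian (E n))) = 0 ∧
      ∫ z, ‖Y (X ω, z)‖ ^ 2 ∂(P.prod (stdGaussian (E n))) ≤ momentBound n Lg μ σ κg := by
    filter_upwards [h4, hκ] with ω hω hκω
    have hl := hω.memLp_zoGrad h5 hμ
    refine ⟨hl.sub (memLp_const (zoMean P F μ (X ω))), ?_, ?_⟩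
    · simp only [Y]
      rw [integral_sub (hl.integrable (by norm_num)) (integrable_const _), integral_const,
        probReal_univ, one_smul, zoMean, sub_self]
    · have a1 := integral_norm_sub_integral_sq hl
      have a2 := hω.integral_norm_zoGrad_sq_le h5 hμ hκω
      simp only [Y, zoMean]
      rw [a1]
      linarith [sq_nonneg ‖∫ z, zoGrad F μ (X ω) z.1 z.2 ∂(P.prod (stdGaussian (E n)))‖]
  obtain ⟨b1, b2, b3⟩ := sum_conditionally_centred hZm hZ hQ hX hY h0 he heS (Finset.Icc 1 m)
  have hm' : (0 : ℝ) < m := by exact_mod_cast hm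
  have hGe : ∀ ω, G ω - zoMean P F μ (X ω) =
      (1 / (m : ℝ)) • ∑ i ∈ Finset.Icc 1 m, Y (X ω, Z (e i) ω) := fun ω => by
    simp only [hG, batchGrad, Y]
    rw [Finset.sum_sub_distrib, smul_sub, Finset.sum_const, Nat.card_Icc, Nat.add_sub_cancel,
      ← Nat.cast_smul_eq_nsmul ℝ, smul_smul, one_div_mul_cancel hm'.ne', one_smul]
  simp_rw [hGe]
  refine ⟨b1.const_smul (1 / (m : ℝ)), ?_, fun ψ hψ hψX => ?_⟩
  · simp_rw [norm_smul, mul_pow]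
    rw [integral_const_mul, Real.norm_of_nonneg (by positivity)]
    calc _ ≤ (1 / (m : ℝ)) ^ 2 * ((Finset.Icc 1 m).card * momentBound n Lg μ σ κg) := by gcongr
      _ = _ := by rw [Nat.card_Icc, Nat.add_sub_cancel]; field_simp
  · simp_rw [inner_smul_right]
    rw [integral_const_mul, b3 ψ hψ hψX, mul_zero]

end Batch

/-! ### Measurability of the iterates. -/

section Measurability

variable {Ω : Type*} [MeasurableSpace Ω] [MeasurableSpace Ξ] {P : Measure Ξ} {f : E n → ℝ}
  {c : E n → E q} {h : E q → ℝ} {F : E n → Ξ → ℝ} {Lg Lh LJ : ℝ≥0}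

theorem measurable_batchGrad_comp (h5 : AS5 P f F Lg) (μ : ℝ) (m : ℕ) {X : Ω → E n}
    (hX : Measurable X) {s : ℕ → Ω → Ξ} {v : ℕ → Ω → E n}
    (hsv : ∀ i, Measurable fun ω => (s i ω, v i ω)) :
    Measurable fun ω => batchGrad F μ m (X ω) (fun i => s i ω) (fun i => v i ω) := by
  have hi : ∀ i, Measurable fun ω => zoGrad F μ (X ω) (s i ω) (v i ω) := fun i => by
    have := (h5.measurable_zoGrad μ).comp (hX.prodMk (hsv i))
    simpa only [Function.comp_def] using this
  exact (Finset.measurable_fun_sum (Finset.Icc 1 m) fun i _ => hi i).const_smul (1 / (m : ℝ))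

/-- Only the samples with index below `k` are required to be measurable, and the σ-algebra on Ω is
arbitrary: with the one generated by these samples, the lemma says that x_k is a function of the
past. -/
theorem measurable_iterate (h1 : AS1 f c Lg LJ) (hh : AS2 h Lh) (h5 : AS5 P f F Lg)
    {γ : ℕ → ℝ} (hγ : ∀ k, 0 < γ k) (m : ℕ → ℕ) (μ : ℝ) (x₁ : E n)
    {s : ℕ → ℕ → Ω → Ξ} {v : ℕ → ℕ → Ω → E n} (k : ℕ)
    (hsv : ∀ j < k, ∀ i, Measurable fun ω => (s j i ω, v j i ω)) :
    Measurable fun ω => iterate F c h γ m μ x₁ (fun j i => s j i ω) (fun j i => v j i ω) k := by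
  induction k with
  | zero => exact measurable_const
  | succ k ih =>
    rcases k with _ | k
    · exact measurable_const
    · have hx := ih fun j hj => hsv j (hj.trans (Nat.lt_succ_self _))
      exact measurable_proxPoint_comp h1 hh (hγ (k + 1)) hx
        (measurable_batchGrad_comp h5 μ (m (k + 1)) hx (hsv (k + 1) (Nat.lt_succ_self _)))

theorem measurable_norm_zoGenGrad_sq (h1 : AS1 f c Lg LJ) (hh : AS2 h Lh) (h5 : AS5 P f F Lg)
    {γ : ℕ → ℝ} (hγ : ∀ k, 0 < γ k) (m : ℕ → ℕ) (μ : ℝ) (x₁ : E n)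
    {s : ℕ → ℕ → Ω → Ξ} {v : ℕ → ℕ → Ω → E n}
    (hsv : ∀ j i, Measurable fun ω => (s j i ω, v j i ω)) (k : ℕ) :
    Measurable fun ω =>
      ‖zoGenGrad F c h γ m μ x₁ (fun j i => s j i ω) (fun j i => v j i ω) k‖ ^ 2 := by
  have hx := measurable_iterate h1 hh h5 hγ m μ x₁ k fun j _ i => hsv j i
  exact (measurable_genGrad_comp h1 hh (hγ k) hx
    (measurable_batchGrad_comp h5 μ (m k) hx (hsv k))).norm.pow_const 2

theorem measurable_norm_trueGenGrad_sq (h1 : AS1 f c Lg LJ) (hh : AS2 h Lh) (h5 : AS5 P f F Lg)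
    {γ : ℕ → ℝ} (hγ : ∀ k, 0 < γ k) (m : ℕ → ℕ) (μ : ℝ) (x₁ : E n)
    {s : ℕ → ℕ → Ω → Ξ} {v : ℕ → ℕ → Ω → E n}
    (hsv : ∀ j i, Measurable fun ω => (s j i ω, v j i ω)) (k : ℕ) :
    Measurable fun ω =>
      ‖trueGenGrad f F c h γ m μ x₁ (fun j i => s j i ω) (fun j i => v j i ω) k‖ ^ 2 := by
  have hx := measurable_iterate h1 hh h5 hγ m μ x₁ k fun j _ i => hsv j i
  exact (measurable_genGrad_comp h1 hh (hγ k) hx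
    (h1.measurable_gradient.comp hx)).norm.pow_const 2

end Measurability

theorem iterate_succ (F : E n → Ξ → ℝ) (c : E n → E q) (h : E q → ℝ) (γ : ℕ → ℝ) (m : ℕ → ℕ)
    (μ : ℝ) (x₁ : E n) (s : ℕ → ℕ → Ξ) (v : ℕ → ℕ → E n) {k : ℕ} (hk : 1 ≤ k) :
    iterate F c h γ m μ x₁ s v (k + 1) = proxPoint c h (γ k) (iterate F c h γ m μ x₁ s v k)
      (batchGrad F μ (m k) (iterate F c h γ m μ x₁ s v k) (s k) (v k)) := by
  obtain ⟨k, rfl⟩ := Nat.exists_eq_succ_of_ne_zero (by omega : k ≠ 0)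
  rfl

/-! ### Telescoping over a run and the random output. -/

section Run

variable {Ω : Type*} [mΩ : MeasurableSpace Ω] {Pr : Measure Ω} [IsProbabilityMeasure Pr]
  [MeasurableSpace Ξ] {P : Measure Ξ} [IsProbabilityMeasure P] {f : E n → ℝ}
  {c : E n → E q} {h : E q → ℝ} {F : E n → Ξ → ℝ} {Lg Lh LJ : ℝ≥0} {Φlow : ℝ}

/-- Second moments of the generalized gradients along a run. -/
theorem run_estimate (h1 : AS1 f c Lg LJ) (hh : AS2 h Lh) (h3 : AS3 f c h Φlow)
    (h5 : AS5 P f F Lg) (hL : 0 < stepL Lg Lh LJ) {γ : ℕ → ℝ}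
    (hγ : ∀ k, γ k = 1 / stepL Lg Lh LJ) {m : ℕ → ℕ} {m₀ : ℕ} (hm : ∀ k, m k = m₀) (hm₀ : 0 < m₀)
    {μ σ κg : ℝ} (hμ : 0 < μ) (x₁ : E n) {ξ : ℕ → ℕ → Ω → Ξ} {v : ℕ → ℕ → Ω → E n} {R : Ω → ℕ}
    {N : ℕ} (hs : IsSampling Pr P (stepL Lg Lh LJ) γ N ξ v R)
    (h4 : ∀ k ∈ Finset.Icc 1 N, ∀ᵐ ω ∂Pr, AS4At P f F σ
      (iterate F c h γ m μ x₁ (fun k i => ξ k i ω) (fun k i => v k i ω) k))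
    (hκ : ∀ k ∈ Finset.Icc 1 N, ∀ᵐ ω ∂Pr, ‖gradient f
      (iterate F c h γ m μ x₁ (fun k i => ξ k i ω) (fun k i => v k i ω) k)‖ ≤ κg)
    {A T : ℕ → Ω → ℝ}
    (hA : A = fun k ω => ‖zoGenGrad F c h γ m μ x₁ (fun k i => ξ k i ω) (fun k i => v k i ω) k‖ ^ 2)
    (hT : T = fun k ω =>
      ‖trueGenGrad f F c h γ m μ x₁ (fun k i => ξ k i ω) (fun k i => v k i ω) k‖ ^ 2) :
    (∀ k ∈ Finset.Icc 1 N, Integrable (A k) Pr ∧ Integrable (T k) Pr ∧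
      ∫ ω, T k ω ∂Pr ≤ 2 * ∫ ω, A k ω ∂Pr + 4 * (momentBound n Lg μ σ κg / m₀) +
        4 * biasBound n Lg μ) ∧
    3 / 8 * ∑ k ∈ Finset.Icc 1 N, ∫ ω, A k ω ∂Pr ≤ stepL Lg Lh LJ * (Phi f c h x₁ - Φlow) +
      N * (momentBound n Lg μ σ κg / m₀ + 2 * biasBound n Lg μ) := by
  have hγ0 : ∀ k, 0 < γ k := fun k => by rw [hγ]; positivity
  let x : ℕ → Ω → E n := fun k ω =>
    iterate F c h γ m μ x₁ (fun k i => ξ k i ω) (fun k i => v k i ω) k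
  let Z : ℕ × ℕ → Ω → Ξ × E n := fun p ω => (ξ p.1 p.2 ω, v p.1 p.2 ω)
  have hZm : ∀ p, Measurable (Z p) := fun p =>
    (hs.measurable_ξ p.1 p.2).prodMk (hs.measurable_v p.1 p.2)
  set V := momentBound n Lg μ σ κg / m₀
  set B := biasBound n Lg μ
  have hstep : ∀ k ∈ Finset.Icc 1 N, Integrable (fun ω => Phi f c h (x k ω)) Pr →
      Integrable (fun ω => Phi f c h (x (k + 1) ω)) Pr ∧ Integrable (A k) Pr ∧
      Integrable (T k) Pr ∧
      ∫ ω, Phi f c h (x (k + 1) ω) ∂Pr + 3 * γ k / 8 * ∫ ω, A k ω ∂Pr ≤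
        ∫ ω, Phi f c h (x k ω) ∂Pr + γ k * (V + 2 * B) ∧
      ∫ ω, T k ω ∂Pr ≤ 2 * ∫ ω, A k ω ∂Pr + 4 * V + 4 * B := by
    intro k hk hΦ
    have hk1 := (Finset.mem_Icc.1 hk).1
    -- Measurability for the past σ-algebra separates x_k from the batch indexed by (k, i).
    have hx : Measurable[⨆ p ∈ {p : ℕ × ℕ | p.1 < k}, MeasurableSpace.comap (Z p) inferInstance]
        (x k) := by
      refine @measurable_iterate n q Ξ Ω (⨆ p ∈ {p : ℕ × ℕ | p.1 < k}, _) _ P f c h F Lg Lh LJ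
        h1 hh h5 γ hγ0 m μ x₁ ξ v k fun j hj i => ?_
      exact (comap_measurable (Z (j, i))).mono (le_iSup₂_of_le (j, i) hj le_rfl) le_rfl
    have hxm : Measurable (x k) := hx.mono (iSup₂_le fun p _ => (hZm p).comap_le) le_rfl
    let G : Ω → E n := fun ω => batchGrad F μ (m k) (x k ω) (fun i => ξ k i ω) (fun i => v k i ω)
    have hG : Measurable G := measurable_batchGrad_comp h5 μ (m k) hxm fun i => hZm (k, i)
    obtain ⟨b1, b2, b3⟩ := batchGrad_noise h5 hμ hZm hs.indep_sample
      (fun p => hs.map_sample p.1 p.2) hx (h4 k hk) (hκ k hk) (e := fun i => (k, i))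
      (fun i j hij => (Prod.mk.inj hij).2) (fun i => by simp) (by rw [hm]; exact hm₀)
      (G := G) rfl
    rw [hm] at b2
    have hB : ∀ᵐ ω ∂Pr, ‖zoMean P F μ (x k ω) - gradient f (x k ω)‖ ^ 2 ≤ B :=
      (h4 k hk).mono fun ω hω => hω.norm_zoMean_sub_sq_le h5 hμ
    have est := step_estimate h1 hh h3 hL (hγ k) hxm hG (h5.measurable_zoMean μ) hΦ b1 b2 b3 hB
    have hx1 : ∀ ω, x (k + 1) ω = proxPoint c h (γ k) (x k ω) (G ω) := fun ω =>
      iterate_succ F c h γ m μ x₁ _ _ hk1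
    simp only [hx1]
    rw [hA, hT]
    exact est
  -- Each step both needs and returns integrability of Φ, so it is carried through the induction
  -- with the telescoped inequality. After k passes the iterate is x_{k+1}.
  have hind : ∀ k ≤ N, Integrable (fun ω => Phi f c h (x (k + 1) ω)) Pr ∧
      ∫ ω, Phi f c h (x (k + 1) ω) ∂Pr +
        3 * (1 / stepL Lg Lh LJ) / 8 * ∑ j ∈ Finset.Icc 1 k, ∫ ω, A j ω ∂Pr ≤
      Phi f c h x₁ + k * (1 / stepL Lg Lh LJ * (V + 2 * B)) := by
    intro k
    induction k with
    | zero =>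
      intro _
      have : ∀ ω, x (0 + 1) ω = x₁ := fun ω => rfl
      simp [this]
    | succ k ih =>
      intro hk
      obtain ⟨i1, i2⟩ := ih (by omega)
      obtain ⟨s1, -, -, s4, -⟩ := hstep (k + 1) (Finset.mem_Icc.2 ⟨by omega, hk⟩) i1
      refine ⟨s1, ?_⟩
      rw [Finset.sum_Icc_succ_top (by omega)]
      rw [hγ] at s4
      push_cast
      linarith
  refine ⟨fun k hk => ?_, ?_⟩
  · obtain ⟨k1, k2⟩ := Finset.mem_Icc.1 hk
    have hi := (hind (k - 1) (by omega)).1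
    rw [Nat.sub_add_cancel k1] at hi
    obtain ⟨-, s2, s3, -, s5⟩ := hstep k hk hi
    exact ⟨s2, s3, s5⟩
  · obtain ⟨i1, i2⟩ := hind N le_rfl
    have hlow : Φlow ≤ ∫ ω, Phi f c h (x (N + 1) ω) ∂Pr := by
      have := integral_mono (integrable_const Φlow) i1 fun ω => h3 (x (N + 1) ω)
      simpa using this
    set L := stepL Lg Lh LJ
    have h6 : 3 * (1 / L) / 8 * ∑ j ∈ Finset.Icc 1 N, ∫ ω, A j ω ∂Pr ≤
        (Phi f c h x₁ - Φlow) + N * (1 / L * (V + 2 * B)) := by linarith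
    calc _ = L * (3 * (1 / L) / 8 * ∑ j ∈ Finset.Icc 1 N, ∫ ω, A j ω ∂Pr) := by field_simp
      _ ≤ L * ((Phi f c h x₁ - Φlow) + N * (1 / L * (V + 2 * B))) := by gcongr
      _ = _ := by field_simp

/-- Equal stepsizes make the weights uniform; at `N = 0` both sides are 0 by the convention for
division. -/
theorem outputPMF_const {L : ℝ} (hL : 0 < L) {γ : ℕ → ℝ} (hγ : ∀ k, γ k = 1 / L) (N k : ℕ) :
    outputPMF L γ N k = 1 / N := by
  have e : ∀ k, γ k - L * γ k ^ 2 / 2 = 1 / (2 * L) := fun k => by rw [hγ]; field_simp; ring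
  rw [outputPMF]
  simp only [e, Finset.sum_const, Nat.card_Icc, Nat.add_sub_cancel, nsmul_eq_mul]
  rcases Nat.eq_zero_or_pos N with rfl | hN
  · simp
  · have : (0 : ℝ) < N := by exact_mod_cast hN
    field_simp

/-- Second moments of the generalized gradients at the random output. -/
theorem output_estimate (h1 : AS1 f c Lg LJ) (hh : AS2 h Lh) (h3 : AS3 f c h Φlow)
    (h5 : AS5 P f F Lg) (hL : 0 < stepL Lg Lh LJ) {γ : ℕ → ℝ}
    (hγ : ∀ k, γ k = 1 / stepL Lg Lh LJ) {m : ℕ → ℕ} {m₀ : ℕ} (hm : ∀ k, m k = m₀) (hm₀ : 0 < m₀)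
    {μ σ κg : ℝ} (hμ : 0 < μ) (x₁ : E n) {ξ : ℕ → ℕ → Ω → Ξ} {v : ℕ → ℕ → Ω → E n} {R : Ω → ℕ}
    {N : ℕ} (hN : 0 < N) (hs : IsSampling Pr P (stepL Lg Lh LJ) γ N ξ v R)
    (h4 : ∀ k ∈ Finset.Icc 1 N, ∀ᵐ ω ∂Pr, AS4At P f F σ
      (iterate F c h γ m μ x₁ (fun k i => ξ k i ω) (fun k i => v k i ω) k))
    (hκ : ∀ k ∈ Finset.Icc 1 N, ∀ᵐ ω ∂Pr, ‖gradient f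
      (iterate F c h γ m μ x₁ (fun k i => ξ k i ω) (fun k i => v k i ω) k)‖ ≤ κg)
    {A T : ℕ → Ω → ℝ}
    (hA : A = fun k ω => ‖zoGenGrad F c h γ m μ x₁ (fun k i => ξ k i ω) (fun k i => v k i ω) k‖ ^ 2)
    (hT : T = fun k ω =>
      ‖trueGenGrad f F c h γ m μ x₁ (fun k i => ξ k i ω) (fun k i => v k i ω) k‖ ^ 2)
    {a : ℝ} (ha : a = 8 / 3 * (stepL Lg Lh LJ * (Phi f c h x₁ - Φlow) / N +
      (momentBound n Lg μ σ κg / m₀ + 2 * biasBound n Lg μ))) :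
    (Integrable (fun ω => A (R ω) ω) Pr ∧ ∫ ω, A (R ω) ω ∂Pr ≤ a) ∧
    (Integrable (fun ω => T (R ω) ω) Pr ∧ ∫ ω, T (R ω) ω ∂Pr ≤
      2 * a + 4 * (momentBound n Lg μ σ κg / m₀) + 4 * biasBound n Lg μ) := by
  obtain ⟨r1, r2⟩ := run_estimate h1 hh h3 h5 hL hγ hm hm₀ hμ x₁ hs h4 hκ hA hT
  have hγ0 : ∀ k, 0 < γ k := fun k => by rw [hγ]; positivity
  let W : Ω → ℕ × ℕ → Ξ × E n := fun ω p => (ξ p.1 p.2 ω, v p.1 p.2 ω)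
  have hWp : ∀ j i, Measurable[MeasurableSpace.comap W inferInstance]
      fun ω => (ξ j i ω, v j i ω) := fun j i =>
    (measurable_pi_apply (j, i)).comp (comap_measurable W)
  -- `R` is independent of the whole array of samples, hence of everything measurable for the
  -- σ-algebra it generates.
  have hR : ∀ φ : Ω → ℝ, Measurable[MeasurableSpace.comap W inferInstance] φ → IndepFun R φ Pr := by
    intro φ hφ
    have := hs.indep_R
    rw [IndepFun_iff_Indep] at this ⊢
    exact indep_of_indep_of_le_right this hφ.comap_le
  have iA : ∀ k, IndepFun R (A k) Pr := fun k => by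
    refine hR _ ?_
    rw [hA]
    exact @measurable_norm_zoGenGrad_sq n q Ξ Ω (MeasurableSpace.comap W inferInstance) _ P f c h
      F Lg Lh LJ h1 hh h5 γ hγ0 m μ x₁ ξ v hWp k
  have iT : ∀ k, IndepFun R (T k) Pr := fun k => by
    refine hR _ ?_
    rw [hT]
    exact @measurable_norm_trueGenGrad_sq n q Ξ Ω (MeasurableSpace.comap W inferInstance) _ P f c h
      F Lg Lh LJ h1 hh h5 γ hγ0 m μ x₁ ξ v hWp k
  have hp : ∀ k ∈ Finset.Icc 1 N, Pr.real {ω | R ω = k} = 1 / N := fun k hk => by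
    rw [hs.prob_R k hk, outputPMF_const hL hγ]
  obtain ⟨a1, a2⟩ := integral_stopped_at_indep hs.measurable_R hs.R_mem
    (fun k hk => (r1 k hk).1) fun k _ => iA k
  obtain ⟨t1, t2⟩ := integral_stopped_at_indep hs.measurable_R hs.R_mem
    (fun k hk => (r1 k hk).2.1) fun k _ => iT k
  rw [Finset.sum_congr rfl fun k hk => by rw [hp k hk], ← Finset.mul_sum] at a2 t2
  have hN' : (0 : ℝ) < N := by exact_mod_cast hN
  set V := momentBound n Lg μ σ κg / m₀
  set B := biasBound n Lg μ
  have hAle : ∫ ω, A (R ω) ω ∂Pr ≤ a := by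
    rw [a2, ha]
    calc _ = 1 / (N : ℝ) * (8 / 3) * (3 / 8 * ∑ k ∈ Finset.Icc 1 N, ∫ ω, A k ω ∂Pr) := by ring
      _ ≤ 1 / (N : ℝ) * (8 / 3) * (stepL Lg Lh LJ * (Phi f c h x₁ - Φlow) + N * (V + 2 * B)) := by
          gcongr
      _ = _ := by field_simp
  refine ⟨⟨a1, hAle⟩, t1, ?_⟩
  calc ∫ ω, T (R ω) ω ∂Pr = 1 / (N : ℝ) * ∑ k ∈ Finset.Icc 1 N, ∫ ω, T k ω ∂Pr := t2
    _ ≤ 1 / (N : ℝ) * ∑ k ∈ Finset.Icc 1 N, (2 * ∫ ω, A k ω ∂Pr + 4 * V + 4 * B) := by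
        gcongr with k hk; exact (r1 k hk).2.2
    _ = 2 * (1 / (N : ℝ) * ∑ k ∈ Finset.Icc 1 N, ∫ ω, A k ω ∂Pr) + 4 * V + 4 * B := by
        simp only [Finset.sum_add_distrib, ← Finset.mul_sum, Finset.sum_const, Nat.card_Icc,
          Nat.add_sub_cancel, nsmul_eq_mul]
        field_simp
    _ ≤ _ := by rw [← a2]; linarith

end Run

/-! ### Arithmetic of the budget. -/

theorem momentBound_nonneg (n : ℕ) (Lg μ σ κg : ℝ) : 0 ≤ momentBound n Lg μ σ κg := by
  unfold momentBound; positivity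

theorem biasBound_nonneg (n : ℕ) (Lg μ : ℝ) : 0 ≤ biasBound n Lg μ := by
  unfold biasBound; positivity

section Budget

variable {L D₂ : ℝ} {Nbar : ℕ}

/-- The hypothesis says exactly that s = √(N̄/D₂)/L is at most N̄. The minimum in the batch size is
then inactive, and m = ⌈max(1, s)⌉. -/
theorem batchSize_bounds (hL : 0 < L) (hD₂ : 0 < D₂) (hN : 1 / (L ^ 2 * D₂) ≤ Nbar) :
    0 < Nbar ∧ 0 < batchSize L D₂ Nbar ∧
    1 / L * √((Nbar : ℝ) / D₂) ≤ batchSize L D₂ Nbar ∧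
    (batchSize L D₂ Nbar : ℝ) ≤ 1 + 1 / L * √((Nbar : ℝ) / D₂) := by
  have hN0 : (0 : ℝ) < Nbar := lt_of_lt_of_le (by positivity) hN
  have hN1 : 0 < Nbar := by exact_mod_cast hN0
  set s := 1 / L * √((Nbar : ℝ) / D₂) with hs
  have hs0 : 0 ≤ s := by positivity
  have hsN : s ≤ Nbar := by
    have h1 : s ^ 2 ≤ (Nbar : ℝ) ^ 2 := by
      rw [hs, mul_pow, Real.sq_sqrt (by positivity)]
      calc (1 / L) ^ 2 * ((Nbar : ℝ) / D₂) = 1 / (L ^ 2 * D₂) * (Nbar : ℝ) := by field_simp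
        _ ≤ (Nbar : ℝ) * Nbar := by gcongr
        _ = _ := by ring
    exact (sq_le_sq₀ hs0 hN0.le).1 h1
  have hb : batchSize L D₂ Nbar = ⌈max 1 s⌉₊ := by
    rw [batchSize, min_eq_right (max_le (by exact_mod_cast hN1) hsN)]
  rw [hb]
  refine ⟨hN1, Nat.ceil_pos.2 (by positivity), (le_max_right 1 s).trans (Nat.le_ceil _), ?_⟩
  rcases le_total s 1 with h | h
  · rw [max_eq_left h, Nat.ceil_one]; push_cast; linarith
  · rw [max_eq_right h]; linarith [Nat.ceil_lt_add_one hs0]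

/-- A run has only R − 1 passes, and R − 1 < ⌈N̄/m⌉ means (R − 1)m < N̄: rounding N up costs no
call. -/
theorem szoCalls_le {m : ℕ → ℕ} {m₀ R : ℕ} (hm : ∀ k, m k = m₀) (hm₀ : 0 < m₀)
    (hR : R ≤ maxIter m₀ Nbar) : szoCalls m R ≤ Nbar := by
  rw [szoCalls, Finset.sum_congr rfl fun k _ => hm k, Finset.sum_const, Nat.card_Icc,
    Nat.add_sub_cancel, smul_eq_mul]
  rcases Nat.eq_zero_or_pos R with rfl | hR0
  · simp
  have hm' : (0 : ℝ) < m₀ := by exact_mod_cast hm₀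
  have h1 : R - 1 < maxIter m₀ Nbar := by omega
  rw [maxIter, Nat.lt_ceil, lt_div_iff₀ hm'] at h1
  exact_mod_cast h1.le

/-- Four quantities control everything: y₁ and y₂ come from LD/N, y₃ from the variance of the
directional part, w from the Taylor remainder. The squared term of the budget bound handles y₂ and
y₃, which decay like N̄^(-1/2); the other term handles y₁ and w, which decay like 1/N̄. -/
theorem budget_arith {n : ℕ} {Lg σ κg D₁ D ε μ : ℝ} (hLg : 0 ≤ Lg) (hLgL : Lg ≤ L) (hL : 0 < L)
    (hD₁ : 0 < D₁) (hD₂ : 0 < D₂) (hD : 0 ≤ D) (hε : 0 < ε)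
    (hN : budgetBound n Lg L σ κg D₁ D₂ D ε ≤ Nbar) (hμ : 0 < μ) (hμN : μ ≤ √(D₁ / (Nbar : ℝ))) :
    2 * (8 / 3 * (L * D / maxIter (batchSize L D₂ Nbar) Nbar +
      (momentBound n Lg μ σ κg / batchSize L D₂ Nbar + 2 * biasBound n Lg μ))) +
      4 * (momentBound n Lg μ σ κg / batchSize L D₂ Nbar) + 4 * biasBound n Lg μ ≤ ε := by
  obtain ⟨hN1, hm, hsm, hms⟩ := batchSize_bounds hL hD₂ ((le_max_right _ _).trans hN)
  have hb := (le_max_left _ _).trans hN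
  set m := batchSize L D₂ Nbar
  have hN0 : (0 : ℝ) < Nbar := by exact_mod_cast hN1
  have hm0 : (0 : ℝ) < m := by exact_mod_cast hm
  have hm1 : (1 : ℝ) ≤ m := by exact_mod_cast hm
  set r := √(Nbar : ℝ) with hr
  set d := √D₂ with hd
  have hr0 : 0 < r := Real.sqrt_pos.2 hN0
  have hd0 : 0 < d := Real.sqrt_pos.2 hD₂
  have hrr : r ^ 2 = Nbar := Real.sq_sqrt hN0.le
  rw [Real.sqrt_div' _ hD₂.le] at hsm hms
  set K := κg ^ 2 + σ ^ 2
  set y₁ := L * D / Nbar with hy₁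
  set y₂ := D / (d * r) with hy₂
  set y₃ := (n + 4) * K * L * d / r with hy₃
  set w := L * Lg * D₁ * (n + 4) ^ 3 / Nbar with hw
  have p₁ : 0 ≤ y₁ := by positivity
  have p₂ : 0 ≤ y₂ := by positivity
  have p₃ : 0 ≤ y₃ := by positivity
  have pw : 0 ≤ w := by positivity
  have c₁ : 16 * y₂ + 24 * y₃ ≤ ε := by
    have h1 : (16 * D / d + L * constC n σ κg D₂) ^ 2 / ε ^ 2 ≤ r ^ 2 := by
      rw [hrr]
      refine le_trans (le_add_of_nonneg_right ?_) hb
      positivity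
    rw [div_le_iff₀ (by positivity), ← mul_pow] at h1
    have h2 := (sq_le_sq₀ (by unfold constC; positivity) (by positivity)).1 h1
    calc 16 * y₂ + 24 * y₃ = (16 * D / d + L * constC n σ κg D₂) / r := by
          rw [hy₂, hy₃, constC, ← hd]; simp only [K]; field_simp
      _ ≤ ε := by rw [div_le_iff₀ hr0]; linarith
  have c₂ : 104 * w + 64 * y₁ ≤ ε := by
    have h1 : (104 * L * Lg * D₁ * (n + 4) ^ 3 + 64 * L * D) / ε ≤ Nbar :=
      le_trans (le_add_of_nonneg_left (by positivity)) hb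
    rw [div_le_iff₀ hε] at h1
    calc 104 * w + 64 * y₁ = (104 * L * Lg * D₁ * (n + 4) ^ 3 + 64 * L * D) / Nbar := by
          rw [hw, hy₁]; field_simp
      _ ≤ ε := by rw [div_le_iff₀ hN0]; linarith
  have hμ2 : μ ^ 2 ≤ D₁ / Nbar := by
    have := pow_le_pow_left₀ hμ.le hμN 2
    rwa [Real.sq_sqrt (by positivity)] at this
  -- One factor L_g is traded for L, to match the constant in the budget bound.
  have hT : Lg ^ 2 * μ ^ 2 * (n * (n + 2) * (n + 4)) ≤ w := by
    have hn : (n : ℝ) * (n + 2) * (n + 4) ≤ (n + 4) ^ 3 := by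
      have : (0 : ℝ) ≤ n := n.cast_nonneg
      nlinarith [sq_nonneg (n : ℝ)]
    calc _ ≤ (Lg * L) * (D₁ / Nbar) * (n + 4) ^ 3 := by
          rw [pow_two Lg]; gcongr
      _ = w := by rw [hw]; ring
  have hinv : 1 / (m : ℝ) ≤ L * d / r := by
    rw [div_le_div_iff₀ hm0 hr0]
    have h1 : L * d * (1 / L * (r / d)) ≤ L * d * m := by gcongr
    have h2 : L * d * (1 / L * (r / d)) = r := by field_simp
    linarith
  have hV : momentBound n Lg μ σ κg / m ≤ w / 2 + 2 * y₃ := by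
    have h1 : Lg ^ 2 * μ ^ 2 / 2 * (n * (n + 2) * (n + 4)) / m ≤ w / 2 := by
      refine (div_le_self (by positivity) hm1).trans ?_
      linarith
    have h2 : 2 * ((n + 2) * K) / m ≤ 2 * y₃ := by
      calc 2 * ((n + 2) * K) / m = 2 * ((n + 2) * K) * (1 / m) := by ring
        _ ≤ 2 * ((n + 4) * K) * (L * d / r) := by gcongr; norm_num
        _ = _ := by rw [hy₃]; ring
    rw [momentBound, add_div]
    linarith
  have hB : biasBound n Lg μ ≤ w / 4 := by rw [biasBound]; linarith
  have hDN : L * D / maxIter m Nbar ≤ y₁ + y₂ := by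
    have h1 : (Nbar : ℝ) / m ≤ maxIter m Nbar := Nat.le_ceil _
    calc L * D / maxIter m Nbar ≤ L * D / (Nbar / m) := by gcongr
      _ = L * D * m / Nbar := by field_simp
      _ ≤ L * D * (1 + 1 / L * (r / d)) / Nbar := by gcongr
      _ = y₁ + y₂ := by rw [hy₁, hy₂, ← hrr]; field_simp
  -- The left side is at most (16/3)(y₁ + y₂) + (56/3)y₃ + (25/3)w, which (5/6)·`c₁` + (1/6)·`c₂`
  -- dominates.
  linarith

/-- For ε ≤ 1 the quantities 1/ε and 1 are at most 1/ε²; the extra 1 in the constant pays for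
rounding up, and |B| appears because `D` and `Lg` may have any sign here. -/
theorem exists_budget_le (n : ℕ) {Lg L : ℝ} (hL : 0 < L) (σ κg D₁ D : ℝ) (hD₂ : 0 < D₂) :
    ∃ C : ℝ, 0 < C ∧ ∀ ε : ℝ, 0 < ε → ε ≤ 1 → ∃ Nbar : ℕ,
      budgetBound n Lg L σ κg D₁ D₂ D ε ≤ Nbar ∧ (Nbar : ℝ) ≤ C / ε ^ 2 := by
  set A := (16 * D / √D₂ + L * constC n σ κg D₂) ^ 2
  set B := 104 * L * Lg * D₁ * (n + 4) ^ 3 + 64 * L * D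
  set T := 1 / (L ^ 2 * D₂)
  have hT : 0 < T := by positivity
  have hA : 0 ≤ A := sq_nonneg _
  refine ⟨A + |B| + T + 1, by positivity, fun ε hε hε1 => ?_⟩
  have hb : budgetBound n Lg L σ κg D₁ D₂ D ε = max (A / ε ^ 2 + B / ε) T := rfl
  have hε2 : ε ^ 2 ≤ 1 := pow_le_one₀ hε.le hε1
  have h0 : 0 ≤ max (A / ε ^ 2 + B / ε) T := hT.le.trans (le_max_right _ _)
  refine ⟨⌈max (A / ε ^ 2 + B / ε) T⌉₊, hb ▸ Nat.le_ceil _, (Nat.ceil_lt_add_one h0).le.trans ?_⟩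
  have h1 : B / ε ≤ |B| / ε ^ 2 := by
    calc B / ε ≤ |B| / ε := by gcongr; exact le_abs_self B
      _ ≤ |B| / ε ^ 2 := by gcongr; nlinarith
  have h2 : T ≤ T / ε ^ 2 := le_div_self hT.le (by positivity) hε2
  have h3 : 1 ≤ 1 / ε ^ 2 := le_div_self zero_le_one (by positivity) hε2
  have h4 : max (A / ε ^ 2 + B / ε) T ≤ A / ε ^ 2 + |B| / ε ^ 2 + T / ε ^ 2 := by
    refine max_le (by linarith [hT.le.trans h2]) ?_
    have : 0 ≤ A / ε ^ 2 := by positivity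
    have : 0 ≤ |B| / ε ^ 2 := by positivity
    linarith
  have e : (A + |B| + T + 1) / ε ^ 2 = A / ε ^ 2 + |B| / ε ^ 2 + T / ε ^ 2 + 1 / ε ^ 2 := by ring
  rw [e]
  linarith

end Budget

/-! ### Assembly. -/

theorem solvesWithBudget (n q : ℕ) (Lg Lh LJ : ℝ≥0) (hL : 0 < stepL Lg Lh LJ)
    (σ κg D₁ D₂ D : ℝ) (hD₁ : 0 < D₁) (hD₂ : 0 < D₂) {ε : ℝ} (hε : 0 < ε) {Nbar : ℕ}
    (hN : budgetBound n Lg (stepL Lg Lh LJ) σ κg D₁ D₂ D ε ≤ Nbar) :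
    SolvesWithBudget.{u, w} n q Lg Lh LJ σ κg D₁ D₂ D ε Nbar := by
  intro Ξ _ P _ f c h F x₁ Φlow h1 hh h3 h5 hD Ω _ Pr _ ξ v R μ L γ m N hLe hγ hm hNe hμ hμN hs h4 hκ
  subst hLe hNe
  obtain ⟨hN1, hm₀, -, -⟩ := batchSize_bounds hL hD₂ ((le_max_right _ _).trans hN)
  have hD0 : 0 ≤ D := by rw [← hD]; linarith [h3 x₁]
  have hLgL : (Lg : ℝ) ≤ stepL Lg Lh LJ := by
    unfold stepL
    linarith [mul_nonneg Lh.coe_nonneg LJ.coe_nonneg]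
  have hNpos : 0 < maxIter (batchSize (stepL Lg Lh LJ) D₂ Nbar) Nbar :=
    Nat.ceil_pos.2 (div_pos (by exact_mod_cast hN1) (by exact_mod_cast hm₀))
  obtain ⟨⟨a1, a2⟩, t1, t2⟩ := output_estimate h1 hh h3 h5 hL hγ hm hm₀ hμ x₁ hNpos hs h4 hκ
    rfl rfl rfl
  have key := budget_arith Lg.coe_nonneg hLgL hL hD₁ hD₂ hD0 hε hN hμ hμN
  rw [hD] at a2 t2
  -- Nonnegativity of all terms gives a ≤ 2a + 4V + 4B, so the bound for the true generalized
  -- gradient also covers the stochastic one.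
  have hVm := div_nonneg (momentBound_nonneg n Lg μ σ κg)
    (Nat.cast_nonneg (α := ℝ) (batchSize (stepL Lg Lh LJ) D₂ Nbar))
  have hB := biasBound_nonneg n Lg μ
  have hDN : 0 ≤ stepL Lg Lh LJ * D / (maxIter (batchSize (stepL Lg Lh LJ) D₂ Nbar) Nbar : ℝ) := by
    positivity
  exact ⟨⟨a1, a2.trans (by linarith)⟩, ⟨t1, t2.trans key⟩, fun ω =>
    szoCalls_le hm hm₀ (Finset.mem_Icc.1 (hs.R_mem ω)).2⟩

end ZOComposite

/-- First part: every budget above the explicit bound suffices. Second part: hence a budget of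
order `ε⁻²` suffices, with a constant that depends only on the dimensions and on the constants
of the problem class. -/
theorem mainTheorem6 (n q : ℕ) (Lg Lh LJ : ℝ≥0) (hL : 0 < ZOComposite.stepL Lg Lh LJ)
    (σ κg D₁ D₂ D : ℝ) (hσ : 0 < σ) (hκg : 0 < κg) (hD₁ : 0 < D₁) (hD₂ : 0 < D₂) :
    (∀ ε : ℝ, 0 < ε → ∀ Nbar : ℕ,
      ZOComposite.budgetBound n Lg (ZOComposite.stepL Lg Lh LJ) σ κg D₁ D₂ D ε ≤ Nbar →
      ZOComposite.SolvesWithBudget.{u, w} n q Lg Lh LJ σ κg D₁ D₂ D ε Nbar) ∧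
    (∃ C : ℝ, 0 < C ∧ ∀ ε : ℝ, 0 < ε → ε ≤ 1 → ∃ Nbar : ℕ,
      ZOComposite.budgetBound n Lg (ZOComposite.stepL Lg Lh LJ) σ κg D₁ D₂ D ε ≤ Nbar ∧
      (Nbar : ℝ) ≤ C / ε ^ 2 ∧
      ZOComposite.SolvesWithBudget.{u, w} n q Lg Lh LJ σ κg D₁ D₂ D ε Nbar) := by
  refine ⟨fun ε hε Nbar hN =>
    ZOComposite.solvesWithBudget n q Lg Lh LJ hL σ κg D₁ D₂ D hD₁ hD₂ hε hN, ?_⟩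
  obtain ⟨C, hC, h⟩ := ZOComposite.exists_budget_le n (Lg := Lg) hL σ κg D₁ D hD₂
  refine ⟨C, hC, fun ε hε hε1 => ?_⟩
  obtain ⟨Nbar, h1, h2⟩ := h ε hε hε1
  exact ⟨Nbar, h1, h2, ZOComposite.solvesWithBudget n q Lg Lh LJ hL σ κg D₁ D₂ D hD₁ hD₂ hε h1⟩
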